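/- Let $d\ge 2$. A circle endomorphism of degree $d$ is an orientation-preserving covering $f:T\to T$ of the unit circle of degree $d$ with $f(1)=1$; it is identified with its lift, the increasing homeomorphism $F:\mathbb R\to\mathbb R$ with $F(0)=0$ and $F(x+1)=F(x)+d$. It is called uniformly symmetric if there is a bounded function $\varepsilon(t)>0$, $t>0$, with $\varepsilon(t)\to0$ as $t\to0^+$, such that $$\frac1{1+\varepsilon(t)}\le\frac{|F^{-n}(x+t)-F^{-n}(x)|}{|F^{-n}(x)-F^{-n}(x-t)|}\le 1+\varepsilon(t)\qquad\text{for all }x\in\mathbb R,\ t>0,\ n\ge1.$$ Let $\Sigma^*$ be the space of left-infinite words $w^*=\cdots j_2j_1j_0$ with digits in $\{0,\dots,d-1\}$, with the product topology, let $\sigma^*(\cdots j_2j_1j_0)=\cdots j_2j_1$ be the right shift, and let $[w_n^*]$ be the right cylinder of all words that end in $w_n^*=j_{n-1}\cdots j_0$. Put $G_j(x)=F^{-1}(x+j)$ and $I_{w_n}=G_{j_{n-1}}\circ\cdots\circ G_{j_0}([0,1])$, and let $v_{n-1}=j_{n-1}\cdots j_1$. The function $\Psi^*:\Sigma^*\to\mathbb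 R$ is the dual derivative of $f$ if $\Psi^*(w^*)=\lim_{n\to\infty}|I_{v_{n-1}}|/|I_{w_n}|$ for every $w^*\in\Sigma^*$. The Teichmüller space $\mathcal{TUS}$ is represented as the set of all dual derivatives of uniformly symmetric circle endomorphisms of degree $d$. For a probability measure $\mu$ on $\Sigma^*$, the induced metric is $d_\mu(w^*,\tilde w^*)=\mu([w_n^*])$ for $w^*\ne\tilde w^*$, where $[w_n^*]$ is the smallest right cylinder containing both points, and $d_\mu(w^*,w^*)=0$. Write $w^*j$ for the word $w^*$ with the digit $j$ added on the right. For functions $\psi,\phi$ on $\Sigma^*$ put $\mathcal L_\psi\phi(w^*)=\sum_{j=0}^{d-1}\phi(w^*j)\psi(w^*j)$. A $g$-function is a continuous $\psi\ge0$ with $\mathcal L_\psi 1=1$; a $g$-measure for it is a probability measure $\mu$ with $\int\mathcal L_\psi\phi\,d\mu=\int\phi\,d\mu$ for all continuous $\phi$. Let $\tilde\mu=\mathcal L_1^*\mu$, i.e. $\tilde\mu(B)=\sum_{j}\mu(\{w^*: w^*j\in B\})$. **Theorem.** Let $\Psi^*\in\mathcal{TUS}$. Then $\Psi^*$ is continuous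 and positive, and there is a Borel probability measure $\mu^*$ on $\Sigma^*$ such that: 1. $\mu^*$ is a dual geometric Gibbs type measure for the continuous potential $-\log\Psi^*$: it is non-atomic, its support is the whole of $\Sigma^*$, and for every $w^*\in\Sigma^*$ $$\frac{d\sigma^*}{dw^*}(w^*)=\lim_{n\to\infty}\frac{\mu^*(\sigma^*([w_n^*]))}{\mu^*([w_n^*])}=\Psi^*(w^*),$$ where $[w_n^*]$ is the right cylinder of length $n$ containing $w^*$; equivalently, $\sigma^*$ has derivative $\Psi^*$ under the induced metric, $\lim_{\tilde w^*\to w^*}d_{\mu^*}(\sigma^*w^*,\sigma^*\tilde w^*)/d_{\mu^*}(w^*,\tilde w^*)=\Psi^*(w^*)$. 2. $1/\Psi^*$ is a $g$-function and $\mu^*$ is a $g$-measure for it. 3. $\mu^*$ is absolutely continuous with respect to $\tilde\mu^*$, and $D_{\mu^*}=\dfrac{d\mu^*}{d\tilde\mu^*}=\dfrac1{\Psi^*}$ holds $\tilde\mu^*$-almost everywhere. 4. $\mu^*$ is $\sigma^*$-invariant, the topological pressure $P(-\log\Psi^*)$ is $0$, and $\mu^*$ is an equilibrium state: $$0=P(-\log\Psi^*)=h_{\mu^*}(\sigma^*)-\int_{\Sigma^*}\log\Psi^*\,d\mu^*=\sup_\nu\Big\{h_\nu(\sigma^*)-\int_{\Sigma^*}\log\Psi^*\,d\nu\Big\},$$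 where $\nu$ runs over all $\sigma^*$-invariant Borel probability measures and $h_\nu(\sigma^*)$ is the measure-theoretic (Kolmogorov–Sinai) entropy. -/

import Mathlib

open MeasureTheory Filter Topology

namespace DualGibbs

/-! ### Circle endomorphisms through their lifts -/

/-- An orientation preserving circle covering `f : T → T` of degree `d` with `f 1 = 1`, given by
its unique lift `F : ℝ → ℝ` with `F 0 = 0`: an increasing bijection (hence a homeomorphism) of the
line such that `F (x + 1) = F x + d`. -/
structure CircleEndomorphism (d : ℕ) where
  lift : ℝ ≃o ℝ
  map_zero : lift 0 = 0
  map_add_one : ∀ x : ℝ, lift (x + 1) = lift x + d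

/-- `f` is uniformly symmetric: the inverse iterates `F⁻ⁿ`, `n > 0`, are symmetric with one common
bounded modulus `ε`. -/
def CircleEndomorphism.UniformlySymmetric {d : ℕ} (f : CircleEndomorphism d) : Prop :=
  ∃ ε : ℝ → ℝ, (∀ t > 0, 0 < ε t) ∧ (∃ C : ℝ, ∀ t > 0, ε t ≤ C) ∧
    Tendsto ε (𝓝[>] 0) (𝓝 0) ∧
    ∀ n : ℕ, 0 < n → ∀ x t : ℝ, 0 < t →
      1 / (1 + ε t) ≤ |f.lift.symm^[n] (x + t) - f.lift.symm^[n] x| /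
          |f.lift.symm^[n] x - f.lift.symm^[n] (x - t)| ∧
      |f.lift.symm^[n] (x + t) - f.lift.symm^[n] x| /
          |f.lift.symm^[n] x - f.lift.symm^[n] (x - t)| ≤ 1 + ε t

/-! ### The dual symbolic space -/

/-- The dual symbolic space `Σ*`. The left-infinite word `⋯ j₂ j₁ j₀` is the sequence
`k ↦ jₖ`, so that the product topology is the right topology, and the right cylinder
`[j_{n-1} ⋯ j₀]` around `w` is `PiNat.cylinder w n = {v | ∀ i < n, v i = w i}`. -/
abbrev DualSpace (d : ℕ) : Type := ℕ → Fin d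

/-- The right shift `σ* (⋯ j₂ j₁ j₀) = ⋯ j₂ j₁`. -/
def shift {d : ℕ} (w : DualSpace d) : DualSpace d := fun k => w (k + 1)

/-- The word `w* j`, obtained from `w*` by adding the digit `j` on the right. -/
def append {d : ℕ} (w : DualSpace d) (j : Fin d) : DualSpace d := fun k => Nat.casesOn k j w

@[simp] theorem append_zero {d : ℕ} (w : DualSpace d) (j : Fin d) : append w j 0 = j := rfl

@[simp] theorem append_succ {d : ℕ} (w : DualSpace d) (j : Fin d) (k : ℕ) :
    append w j (k + 1) = w k := rfl

/-- The preimages of `w*` under `σ*` are exactly the words `w* j`. -/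
theorem shift_eq_iff {d : ℕ} (v w : DualSpace d) : shift v = w ↔ ∃ j, v = append w j := by
  constructor
  · rintro rfl
    refine ⟨v 0, funext fun k => ?_⟩
    cases k <;> rfl
  · rintro ⟨j, rfl⟩
    rfl

/-- Different digits give different preimages. -/
theorem append_injective {d : ℕ} (w : DualSpace d) : Function.Injective (append w) :=
  fun i j h => by simpa using congrFun h 0

/-! ### The dual derivative -/

/-- For `w* = ⋯ j₁ j₀`, the composition `G_{j_{n-1}} ∘ ⋯ ∘ G_{j₀}` of the inverse branches
`G_j x = F⁻¹ (x + j)`. -/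
noncomputable def inverseBranch {d : ℕ} (f : CircleEndomorphism d) (w : DualSpace d) :
    ℕ → ℝ → ℝ
  | 0, x => x
  | n + 1, x => f.lift.symm (inverseBranch f w n x + (w n : ℕ))

/-- The interval `I_{w_n} = G_{j_{n-1}} ∘ ⋯ ∘ G_{j₀} ([0,1])` of the `n`-th Markov partition
labelled by the word `w_n = j_{n-1} ⋯ j₀`. -/
def markovInterval {d : ℕ} (f : CircleEndomorphism d) (w : DualSpace d) (n : ℕ) : Set ℝ :=
  inverseBranch f w n '' Set.Icc 0 1

/-- The length `|I_{w_n}|`. -/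
noncomputable def markovLength {d : ℕ} (f : CircleEndomorphism d) (w : DualSpace d) (n : ℕ) : ℝ :=
  inverseBranch f w n 1 - inverseBranch f w n 0

theorem inverseBranch_strictMono {d : ℕ} (f : CircleEndomorphism d) (w : DualSpace d) (n : ℕ) :
    StrictMono (inverseBranch f w n) := by
  induction n with
  | zero => exact fun x y h => h
  | succ n ih =>
    intro x y h
    exact f.lift.symm.strictMono (by simpa using ih h)

theorem inverseBranch_continuous {d : ℕ} (f : CircleEndomorphism d) (w : DualSpace d) (n : ℕ) :
    Continuous (inverseBranch f w n) := by
  induction n with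
  | zero => exact continuous_id
  | succ n ih =>
    exact f.lift.symm.continuous.comp (ih.add continuous_const)

/-- `markovInterval f w n` is a compact interval. -/
theorem markovInterval_eq {d : ℕ} (f : CircleEndomorphism d) (w : DualSpace d) (n : ℕ) :
    markovInterval f w n = Set.Icc (inverseBranch f w n 0) (inverseBranch f w n 1) := by
  apply Set.Subset.antisymm
  · rintro _ ⟨x, hx, rfl⟩
    exact ⟨(inverseBranch_strictMono f w n).monotone hx.1,
      (inverseBranch_strictMono f w n).monotone hx.2⟩
  · exact intermediate_value_Icc zero_le_one (inverseBranch_continuous f w n).continuousOn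

/-- `markovLength f w n` is the Lebesgue length of `markovInterval f w n`. -/
theorem markovLength_eq {d : ℕ} (f : CircleEndomorphism d) (w : DualSpace d) (n : ℕ) :
    markovLength f w n = volume.real (markovInterval f w n) := by
  rw [markovInterval_eq, Real.volume_real_Icc_of_le
    ((inverseBranch_strictMono f w n).monotone zero_le_one), markovLength]

/-- `Ψ` is the dual derivative `D*(f)`: for every `w*`, with `w_n = j_{n-1} ⋯ j₀` and
`v_{n-1} = σ* (w_n)`, the ratios `|I_{v_{n-1}}| / |I_{w_n}|` converge to `Ψ w*`. -/
def IsDualDerivative {d : ℕ} (f : CircleEndomorphism d) (Ψ : DualSpace d → ℝ) : Prop :=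
  ∀ w : DualSpace d,
    Tendsto (fun n : ℕ => markovLength f (shift w) n / markovLength f w (n + 1)) atTop (𝓝 (Ψ w))

/-- The Teichmüller space of uniformly symmetric circle endomorphisms of degree `d`, represented
as the set of their dual derivatives. -/
def TeichmullerUS (d : ℕ) : Set (DualSpace d → ℝ) :=
  {Ψ | ∃ f : CircleEndomorphism d, f.UniformlySymmetric ∧ IsDualDerivative f Ψ}

/-! ### The metric induced by a measure and the derivative of the shift -/

open Classical in
/-- The metric on `Σ*` induced by `μ`: the distance of two different points is the measure of the
smallest right cylinder that contains both (`PiNat.firstDiff w v` is the number of digits, counted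
from the right, in which they agree). -/
noncomputable def inducedDist {d : ℕ} (μ : Measure (DualSpace d)) (w v : DualSpace d) : ℝ :=
  if w = v then 0 else μ.real (PiNat.cylinder w (PiNat.firstDiff w v))

/-- `σ*` has derivative `L` at `w` with respect to the metric induced by `μ`. -/
def HasShiftDerivAt {d : ℕ} (μ : Measure (DualSpace d)) (L : ℝ) (w : DualSpace d) : Prop :=
  Tendsto (fun v => inducedDist μ (shift w) (shift v) / inducedDist μ w v) (𝓝[≠] w) (𝓝 L)

/-- The derivative `dσ*/dw*` at `w` equals `L`, computed on right cylinders: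
`μ (σ* [w_n]) / μ [w_n] → L`. -/
def HasCylinderDerivAt {d : ℕ} (μ : Measure (DualSpace d)) (L : ℝ) (w : DualSpace d) : Prop :=
  Tendsto (fun n : ℕ => μ.real (shift '' PiNat.cylinder w n) / μ.real (PiNat.cylinder w n))
    atTop (𝓝 L)

/-- A dual geometric Gibbs type measure for the potential `-log Ψ`: a non-atomic probability
measure with support the whole of `Σ*` such that `dσ*/dw* = Ψ` everywhere. -/
structure IsDualGeometricGibbsTypeMeasure {d : ℕ} (μ : Measure (DualSpace d))
    (Ψ : DualSpace d → ℝ) : Prop where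
  isProbabilityMeasure : IsProbabilityMeasure μ
  noAtoms : ∀ w, μ {w} = 0
  fullSupport : ∀ U : Set (DualSpace d), IsOpen U → U.Nonempty → 0 < μ U
  derivCylinder : ∀ w, HasCylinderDerivAt μ (Ψ w) w
  derivMetric : ∀ w, HasShiftDerivAt μ (Ψ w) w

/-! ### `g`-measures -/

/-- A `g`-function: continuous, non-negative, and with sum `1` over the preimages of any point. -/
structure IsGFunction {d : ℕ} (ψ : DualSpace d → ℝ) : Prop where
  continuous : Continuous ψ
  nonneg : ∀ w, 0 ≤ ψ w
  sum_eq_one : ∀ w, ∑ j : Fin d, ψ (append w j) = 1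

/-- The transfer operator `(𝓛_ψ φ) w = ∑_{σ* v = w} φ v * ψ v`. -/
def transfer {d : ℕ} (ψ φ : DualSpace d → ℝ) (w : DualSpace d) : ℝ :=
  ∑ j : Fin d, φ (append w j) * ψ (append w j)

/-- `μ` is a `g`-measure for `ψ`: a probability measure with `𝓛_ψ^* μ = μ`, that is,
`⟨𝓛_ψ φ, μ⟩ = ⟨φ, μ⟩` for all continuous `φ`. -/
structure IsGMeasure {d : ℕ} (ψ : DualSpace d → ℝ) (μ : Measure (DualSpace d)) : Prop where
  isProbabilityMeasure : IsProbabilityMeasure μ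
  fixed : ∀ φ : DualSpace d → ℝ, Continuous φ → ∫ w, transfer ψ φ w ∂μ = ∫ w, φ w ∂μ

/-- The measure `μ̃ = 𝓛_1^* μ`, with `μ̃ B = ∑_j μ {w | w j ∈ B} = ∑_j μ (σ* (B ∩ [j]))`. -/
noncomputable def tildeMeasure {d : ℕ} (μ : Measure (DualSpace d)) : Measure (DualSpace d) :=
  ∑ j : Fin d, μ.map (fun w => append w j)

theorem continuous_append {d : ℕ} (j : Fin d) :
    Continuous (fun w : DualSpace d => append w j) := by
  refine continuous_pi fun k => ?_
  cases k with
  | zero => exact continuous_const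
  | succ k => exact continuous_apply k

/-- `⟨φ, μ̃⟩ = ⟨𝓛_1 φ, μ⟩`, the property that characterises `μ̃`. -/
theorem integral_tildeMeasure {d : ℕ} (μ : Measure (DualSpace d)) [IsFiniteMeasure μ]
    (φ : DualSpace d → ℝ) (hφ : Continuous φ) :
    ∫ w, φ w ∂(tildeMeasure μ) = ∫ w, transfer (fun _ => 1) φ w ∂μ := by
  have hint : ∀ (ν : Measure (DualSpace d)) [IsFiniteMeasure ν] (g : DualSpace d → ℝ),
      Continuous g → Integrable g ν := fun ν _ g hg =>
    hg.integrable_of_hasCompactSupport (HasCompactSupport.of_compactSpace g)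
  have hm : ∀ j : Fin d, Measurable (fun w : DualSpace d => append w j) :=
    fun j => (continuous_append j).measurable
  simp only [tildeMeasure, transfer, mul_one]
  rw [integral_finsetSum_measure (fun j _ => hint _ φ hφ),
    integral_finsetSum _ (fun j _ =>
      (hint μ _ (hφ.comp (continuous_append j)) : Integrable (fun w => φ (append w j)) μ))]
  exact Finset.sum_congr rfl fun j _ =>
    integral_map (hm j).aemeasurable hφ.aestronglyMeasurable

/-! ### Entropy, pressure, equilibrium states -/

/-- The Shannon entropy of the finite partition of `X` into the fibres of `ζ`. -/
noncomputable def partitionEntropy {X ι : Type*} [MeasurableSpace X] [Fintype ι]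
    (μ : Measure X) (ζ : X → ι) : ℝ :=
  ∑ a : ι, Real.negMulLog (μ.real (ζ ⁻¹' {a}))

/-- The label of a point in the join `ξ ∨ T⁻¹ ξ ∨ ⋯ ∨ T^{-(n-1)} ξ`. -/
def itinerary {X ι : Type*} (T : X → X) (ξ : X → ι) (n : ℕ) (x : X) : Fin n → ι :=
  fun i => ξ (T^[i] x)

/-- The Kolmogorov–Sinai entropy `h_μ(T)`: the supremum over all finite measurable partitions `ξ`
(given by their labelling functions `X → Fin k`) of
`lim (1/n) H_μ (ξ ∨ T⁻¹ ξ ∨ ⋯ ∨ T^{-(n-1)} ξ)`. The limit exists whenever `μ` is a `T`-invariant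
probability measure; it is written as an upper limit. -/
noncomputable def metricEntropy {X : Type*} [MeasurableSpace X] (μ : Measure X) (T : X → X) :
    EReal :=
  ⨆ (k : ℕ) (ξ : X → Fin k) (_ : Measurable ξ),
    limsup (fun n : ℕ => ((partitionEntropy μ (itinerary T ξ n) / n : ℝ) : EReal)) atTop

/-- The topological pressure of the potential `φ` for `σ*` exists and equals `P`:
`(1/n) log ∑_{w_n} sup_{w ∈ [w_n]} exp (φ w + φ (σ* w) + ⋯ + φ (σ*^{n-1} w)) → P`. -/
def HasPressure {d : ℕ} (φ : DualSpace d → ℝ) (P : ℝ) : Prop :=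
  Tendsto (fun n : ℕ => Real.log (∑ u : Fin n → Fin d,
      sSup ((fun w => Real.exp (birkhoffSum shift φ n w)) ''
        {w : DualSpace d | ∀ i : Fin n, w i = u i})) / n) atTop (𝓝 P)

/-- A `σ*`-invariant Borel probability measure. -/
def IsInvariantProbability {d : ℕ} (μ : Measure (DualSpace d)) : Prop :=
  IsProbabilityMeasure μ ∧ MeasurePreserving shift μ μ

/-- The free energy `h_ν(σ*) + ∫ φ dν`. -/
noncomputable def freeEnergy {d : ℕ} (φ : DualSpace d → ℝ) (ν : Measure (DualSpace d)) : EReal :=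
  metricEntropy ν shift + ((∫ w, φ w ∂ν : ℝ) : EReal)

/-- `μ` is an equilibrium state of pressure `P` for `φ`: it is invariant, `P` is the topological
pressure of `φ`, and
`P = h_μ(σ*) + ∫ φ dμ = sup {h_ν(σ*) + ∫ φ dν | ν a σ*-invariant probability measure}`. -/
structure IsEquilibriumState {d : ℕ} (μ : Measure (DualSpace d)) (φ : DualSpace d → ℝ)
    (P : ℝ) : Prop where
  invariant : IsInvariantProbability μ
  pressure : HasPressure φ P
  attained : freeEnergy φ μ = (P : EReal)
  variational : IsLUB {e | ∃ ν, IsInvariantProbability ν ∧ e = freeEnergy φ ν} (P : EReal)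

end DualGibbs

namespace DualGibbs

/-! ### Distortion of quasisymmetric maps -/

/-! Put g = 1/Ψ*. The plan is to show that g is a positive g-function, to take any g-measure μ for
it, and to read the four assertions off the identity μ = g · μ̃.

Regularity of g. Every inverse branch of order n is F⁻ⁿ after an integer translation, so uniform
symmetry controls all branches at once. At scale 1 it makes the d subintervals of a Markov interval
comparable, so Markov intervals shrink exponentially. At small scales it makes F⁻ᵐ almost affine on
short intervals, uniformly in m (`exists_distortion`). Passing from level n to level n + m applies
such a map to a short interval and so hardly changes the ratio of child to parent
(`markovRatio_cauchy`). Hence g is a uniform limit of continuous functions, and its sums over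
preimages are 1 because children fill their parent.

Gibbs property. A g-measure comes from averaging the iterates of the dual transfer operator. For it,
μ[w_{n+1}] is the integral of v ↦ g(v j₀) over [v_n], so μ[w_{n+1}] / μ[v_n] tends to g(w*) by
continuity. Telescoping gives log μ[w_n] = S_n log g up to an error nη + M for every η > 0
(`IsWeakGibbs`). No summable variation of log g is needed.

Equilibrium. The weak Gibbs property gives pressure 0, and the partition by the last digit gives h_μ
≥ -∫ log g dμ. For an arbitrary invariant ν and an arbitrary finite partition,
`IsWeakGibbs.partitionEntropy_le` bounds the entropy by Gibbs' inequality against a reference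
distribution built from μ: the itinerary of a μ-random point with respect to an approximating
cylinder partition, passed through a noisy channel. -/

theorem le_pow_mul_of_adjacent {M : ℝ} (hM : 1 ≤ M) {ℓ : ℕ → ℝ} (h0 : ∀ i, 0 ≤ ℓ i)
    (h1 : ∀ i, ℓ i ≤ M * ℓ (i + 1)) (h2 : ∀ i, ℓ (i + 1) ≤ M * ℓ i) {N i j : ℕ}
    (hi : i < N) (hj : j < N) : ℓ i ≤ M ^ N * ℓ j := by
  have up : ∀ i k, ℓ i ≤ M ^ k * ℓ (i + k) := by
    intro i k
    induction k with
    | zero => simp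
    | succ k ih =>
      calc ℓ i ≤ M ^ k * ℓ (i + k) := ih
        _ ≤ M ^ k * (M * ℓ (i + k + 1)) := by gcongr; exact h1 _
        _ = M ^ (k + 1) * ℓ (i + (k + 1)) := by rw [pow_succ, mul_assoc, add_assoc]
  have down : ∀ i k, ℓ (i + k) ≤ M ^ k * ℓ i := by
    intro i k
    induction k with
    | zero => simp
    | succ k ih =>
      calc ℓ (i + (k + 1)) ≤ M * ℓ (i + k) := h2 _
        _ ≤ M * (M ^ k * ℓ i) := by gcongr
        _ = M ^ (k + 1) * ℓ i := by ring
  rcases le_total i j with h | h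
  · obtain ⟨k, rfl⟩ := Nat.exists_eq_add_of_le h
    exact (up i k).trans (mul_le_mul_of_nonneg_right (pow_le_pow_right₀ hM (by omega)) (h0 _))
  · obtain ⟨k, rfl⟩ := Nat.exists_eq_add_of_le h
    exact (down j k).trans (mul_le_mul_of_nonneg_right (pow_le_pow_right₀ hM (by omega)) (h0 _))

/-- At the scale `t`, the map `h` is symmetric up to the factor `M`. -/
def SymmetricAtScale (h : ℝ → ℝ) (t M : ℝ) : Prop :=
  ∀ x, h (x + t) - h x ≤ M * (h x - h (x - t)) ∧ h x - h (x - t) ≤ M * (h (x + t) - h x)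

theorem SymmetricAtScale.step_le {h : ℝ → ℝ} (hmono : StrictMono h) {t M : ℝ} (ht : 0 < t)
    (hM : 1 ≤ M) (hs : SymmetricAtScale h t M) (a : ℝ) {N i j : ℕ} (hi : i < N) (hj : j < N) :
    h (a + ((i + 1 : ℕ) : ℝ) * t) - h (a + (i : ℝ) * t) ≤
      M ^ N * (h (a + ((j + 1 : ℕ) : ℝ) * t) - h (a + (j : ℝ) * t)) := by
  refine le_pow_mul_of_adjacent (ℓ := fun i : ℕ => h (a + ((i + 1 : ℕ) : ℝ) * t) - h (a + (i : ℝ) * t))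
    hM (fun i => ?_) (fun i => ?_) (fun i => ?_) hi hj
  · refine sub_nonneg.2 (hmono.monotone ?_)
    push_cast
    linarith
  · have := (hs (a + ((i + 1 : ℕ) : ℝ) * t)).2
    convert this using 3 <;> · push_cast; ring_nf
  · have := (hs (a + ((i + 1 : ℕ) : ℝ) * t)).1
    convert this using 3 <;> · push_cast; ring_nf

/-- Locates y in one of N cells of length t. The right endpoint y = N * t belongs to the last cell,
where the floor would overshoot. -/
theorem exists_nat_mul_le_le_succ_mul {y t : ℝ} (ht : 0 < t) (hy : 0 ≤ y) {N : ℕ} (hN : 0 < N)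
    (hyN : y ≤ N * t) : ∃ p < N, p * t ≤ y ∧ y ≤ ((p + 1 : ℕ) : ℝ) * t := by
  rcases eq_or_lt_of_le hyN with h | h
  · refine ⟨N - 1, by omega, ?_, ?_⟩
    · rw [h]
      gcongr
      omega
    · rw [Nat.sub_add_cancel hN]
      exact hyN
  · refine ⟨⌊y / t⌋₊, ?_, ?_, ?_⟩
    · rw [Nat.floor_lt (by positivity)]
      rwa [div_lt_iff₀ ht]
    · rw [← le_div_iff₀ ht]
      exact Nat.floor_le (by positivity)
    · rw [← div_le_iff₀ ht]
      push_cast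
      exact (Nat.lt_floor_add_one _).le

/-- A map that is symmetric up to `M` at the scale `t` is close to an affine map on intervals of
length `N * t`. -/
theorem SymmetricAtScale.abs_sub_le {h : ℝ → ℝ} (hmono : StrictMono h) {t M : ℝ} (ht : 0 < t)
    (hM : 1 ≤ M) (hs : SymmetricAtScale h t M) (a : ℝ) {N : ℕ} (hN : 0 < N) {x : ℝ}
    (hax : a ≤ x) (hxb : x ≤ a + N * t) :
    |(h x - h a) / (h (a + N * t) - h a) - (x - a) / (N * t)| ≤ M ^ N - 1 + 1 / N := by
  set H := h (a + N * t) - h a with hH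
  have hNr : (0 : ℝ) < N := by exact_mod_cast hN
  have hHpos : 0 < H := sub_pos.2 (hmono (by linarith [mul_pos hNr ht]))
  set ρ := M ^ N with hρ
  have hρ1 : 1 ≤ ρ := one_le_pow₀ hM
  have hsum : ∀ p : ℕ, ∑ i ∈ Finset.range p,
      (h (a + ((i + 1 : ℕ) : ℝ) * t) - h (a + (i : ℝ) * t)) = h (a + p * t) - h a := by
    intro p
    rw [Finset.sum_range_sub (fun i : ℕ => h (a + (i : ℝ) * t))]
    simp
  -- Any two of the N cells have images comparable up to ρ. Summing over all pairs of one of the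
  -- first p cells and one of the N cells compares the image of the first p cells with p/N of the
  -- total, from above here and from below in `key2`.
  have key1 : ∀ p ≤ N, N * (h (a + p * t) - h a) ≤ p * ρ * H := by
    intro p hp
    rw [hH, ← hsum, ← hsum, mul_assoc, Finset.mul_sum, Finset.mul_sum, Finset.mul_sum]
    have : ∀ i ∈ Finset.range p, (N : ℝ) * (h (a + ((i + 1 : ℕ) : ℝ) * t) - h (a + (i : ℝ) * t)) ≤
        ∑ j ∈ Finset.range N, ρ * (h (a + ((j + 1 : ℕ) : ℝ) * t) - h (a + (j : ℝ) * t)) := by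
      intro i hi
      have := Finset.card_nsmul_le_sum (Finset.range N)
        (fun j : ℕ => ρ * (h (a + ((j + 1 : ℕ) : ℝ) * t) - h (a + (j : ℝ) * t))) _
        (fun j hj => hs.step_le hmono ht hM a ((Finset.mem_range.1 hi).trans_le hp)
          (Finset.mem_range.1 hj))
      simpa using this
    have := Finset.sum_le_card_nsmul _ _ _ this
    simpa [Finset.mul_sum] using this
  have key2 : ∀ p ≤ N, p * H ≤ N * (ρ * (h (a + p * t) - h a)) := by
    intro p hp
    rw [hH, ← hsum, ← hsum, Finset.mul_sum]
    have : ∀ i ∈ Finset.range N, (p : ℝ) * (h (a + ((i + 1 : ℕ) : ℝ) * t) - h (a + (i : ℝ) * t)) ≤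
        ∑ j ∈ Finset.range p, ρ * (h (a + ((j + 1 : ℕ) : ℝ) * t) - h (a + (j : ℝ) * t)) := by
      intro i hi
      have := Finset.card_nsmul_le_sum (Finset.range p)
        (fun j : ℕ => ρ * (h (a + ((j + 1 : ℕ) : ℝ) * t) - h (a + (j : ℝ) * t))) _
        (fun j hj => hs.step_le hmono ht hM a (Finset.mem_range.1 hi)
          ((Finset.mem_range.1 hj).trans_le hp))
      simpa using this
    have := Finset.sum_le_card_nsmul _ _ _ this
    simpa [Finset.mul_sum, -Finset.sum_sub_distrib] using this
  obtain ⟨p, hpN, hp1, hp2⟩ := exists_nat_mul_le_le_succ_mul ht (sub_nonneg.2 hax) hN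
    (by linarith : x - a ≤ N * t)
  have hpNr : (p : ℝ) + 1 ≤ N := by exact_mod_cast hpN
  have e1 : h (a + p * t) - h a ≤ h x - h a :=
    sub_le_sub_right (hmono.monotone (by linarith)) _
  have e2 : h x - h a ≤ h (a + ((p + 1 : ℕ) : ℝ) * t) - h a :=
    sub_le_sub_right (hmono.monotone (by linarith)) _
  have e3 : h x - h a ≤ H := sub_le_sub_right (hmono.monotone hxb) _
  have k1 := key1 (p + 1) hpN
  have k2 := key2 p hpN.le
  -- With x in the cell number p, both the image proportion and the true proportion are near p/N:
  -- comparability costs ρ - 1 and the cell width costs 1/N.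
  have u1 : (h x - h a) / H ≤ (p + 1) * ρ / N := by
    rw [div_le_div_iff₀ hHpos hNr]
    push_cast at k1 e2
    nlinarith
  have u2 : (p : ℝ) / N ≤ ρ * ((h x - h a) / H) := by
    rw [← mul_div_assoc, div_le_div_iff₀ hNr hHpos]
    have : N * (ρ * (h (a + p * t) - h a)) ≤ N * (ρ * (h x - h a)) := by gcongr
    linarith
  have u3 : (h x - h a) / H ≤ 1 := (div_le_one hHpos).2 e3
  have v1 : (p : ℝ) / N ≤ (x - a) / (N * t) := by
    rw [div_le_div_iff₀ hNr (by positivity)]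
    nlinarith
  have v2 : (x - a) / (N * t) ≤ (p + 1) / N := by
    rw [div_le_div_iff₀ (by positivity) hNr]
    push_cast at hp2
    nlinarith
  have v3 : ((p : ℝ) + 1) / N ≤ 1 := (div_le_one hNr).2 hpNr
  rw [abs_le]
  constructor
  · rw [add_div] at v2
    nlinarith
  · have : (p + 1) * ρ / N = (p + 1) / N * (ρ - 1) + (p / N + 1 / N) := by ring
    nlinarith

/-! ### Inverse branches -/

section Circle

variable {d : ℕ} (f : CircleEndomorphism d)

theorem CircleEndomorphism.symm_add_nat_mul (x : ℝ) (k : ℕ) :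
    f.lift.symm (x + d * k) = f.lift.symm x + k := by
  rw [OrderIso.symm_apply_eq]
  induction k with
  | zero => simp
  | succ k ih =>
    push_cast
    rw [← add_assoc, f.map_add_one, ← ih]
    ring

theorem CircleEndomorphism.symm_zero : f.lift.symm 0 = 0 := by
  rw [OrderIso.symm_apply_eq, f.map_zero]

theorem CircleEndomorphism.symm_degree : f.lift.symm d = 1 := by
  simpa [f.symm_zero] using f.symm_add_nat_mul 0 1

theorem CircleEndomorphism.iterate_symm_add (n k : ℕ) (x : ℝ) :
    f.lift.symm^[n] (x + d ^ n * k) = f.lift.symm^[n] x + k := by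
  induction n generalizing x with
  | zero => simp
  | succ n ih =>
    have : x + (d : ℝ) ^ (n + 1) * k = x + d * ((d ^ n * k : ℕ) : ℝ) := by push_cast; ring
    rw [Function.iterate_succ_apply, Function.iterate_succ_apply, this, f.symm_add_nat_mul]
    push_cast
    exact ih _

theorem CircleEndomorphism.iterate_symm_strictMono (n : ℕ) : StrictMono f.lift.symm^[n] :=
  f.lift.symm.strictMono.iterate n

/-- Since F⁻ⁿ(x + dⁿk) = F⁻ⁿ(x) + k, the digit added after n steps can be moved in front of F⁻ⁿ.
This transfers estimates on F⁻ⁿ, uniform in the base point, to every branch. -/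
theorem exists_inverseBranch_eq (w : DualSpace d) (n : ℕ) :
    ∃ k : ℕ, ∀ x, inverseBranch f w n x = f.lift.symm^[n] (x + k) := by
  induction n with
  | zero => exact ⟨0, fun x => by simp [inverseBranch]⟩
  | succ n ih =>
    obtain ⟨k, hk⟩ := ih
    refine ⟨k + d ^ n * (w n : ℕ), fun x => ?_⟩
    rw [inverseBranch, hk, ← f.iterate_symm_add, Function.iterate_succ_apply']
    push_cast
    rw [add_assoc]

theorem iterate_shift_apply (w : DualSpace d) (n k : ℕ) : (shift^[n] w) k = w (n + k) := by
  induction n generalizing k with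
  | zero => simp
  | succ n ih =>
    rw [Function.iterate_succ_apply', shift, ih]
    congr 1
    omega

theorem inverseBranch_add (w : DualSpace d) (n m : ℕ) (x : ℝ) :
    inverseBranch f w (n + m) x = inverseBranch f (shift^[n] w) m (inverseBranch f w n x) := by
  induction m with
  | zero => rfl
  | succ m ih => rw [← add_assoc, inverseBranch, ih, inverseBranch, iterate_shift_apply]

theorem inverseBranch_succ (w : DualSpace d) (n : ℕ) (x : ℝ) :
    inverseBranch f w (n + 1) x = inverseBranch f (shift w) n (f.lift.symm (x + (w 0 : ℕ))) := by
  rw [add_comm, inverseBranch_add]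
  rfl

theorem markovLength_pos (w : DualSpace d) (n : ℕ) : 0 < markovLength f w n :=
  sub_pos.2 (inverseBranch_strictMono f w n zero_lt_one)

/-- The proportion of `I_{w_{n+1}}` in its parent interval `I_{v_n}`. -/
noncomputable def markovRatio (n : ℕ) (w : DualSpace d) : ℝ :=
  markovLength f w (n + 1) / markovLength f (shift w) n

theorem shift_append (w : DualSpace d) (j : Fin d) : shift (append w j) = w := rfl

theorem markovLength_succ (w : DualSpace d) (n : ℕ) :
    markovLength f w (n + 1) = inverseBranch f (shift w) n (f.lift.symm (((w 0 : ℕ) + 1 : ℕ) : ℝ)) -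
      inverseBranch f (shift w) n (f.lift.symm ((w 0 : ℕ) : ℝ)) := by
  rw [markovLength, inverseBranch_succ, inverseBranch_succ, zero_add]
  push_cast
  rw [add_comm 1]

/-- The points F⁻¹(0), …, F⁻¹(d) cut [0,1] into d pieces, so the sum over the children telescopes.
-/
theorem sum_markovLength_append (w : DualSpace d) (n : ℕ) :
    ∑ j, markovLength f (append w j) (n + 1) = markovLength f w n := by
  simp only [markovLength_succ, shift_append, append_zero]
  rw [Fin.sum_univ_eq_sum_range (fun j : ℕ => inverseBranch f w n (f.lift.symm ((j + 1 : ℕ) : ℝ)) -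
      inverseBranch f w n (f.lift.symm (j : ℝ))),
    Finset.sum_range_sub (fun j : ℕ => inverseBranch f w n (f.lift.symm (j : ℝ)))]
  simp [markovLength, f.symm_zero, f.symm_degree]

theorem sum_markovRatio_append (w : DualSpace d) (n : ℕ) :
    ∑ j, markovRatio f n (append w j) = 1 := by
  simp only [markovRatio, shift_append]
  rw [← Finset.sum_div, sum_markovLength_append, div_self (markovLength_pos f w n).ne']

/-! ### Bounded geometry and uniform convergence of the ratios -/

variable {f}

/-- Clears the quotients and absolute values, and adds the case n = 0, where the map is the
identity. -/
theorem CircleEndomorphism.UniformlySymmetric.exists_modulus (hf : f.UniformlySymmetric) :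
    ∃ ε : ℝ → ℝ, (∀ t > 0, 0 < ε t) ∧ Tendsto ε (𝓝[>] 0) (𝓝 0) ∧
      ∀ n, ∀ t > 0, SymmetricAtScale f.lift.symm^[n] t (1 + ε t) := by
  obtain ⟨ε, hpos, -, hlim, h⟩ := hf
  refine ⟨ε, hpos, hlim, fun n t ht x => ?_⟩
  have hε := hpos t ht
  rcases Nat.eq_zero_or_pos n with rfl | hn
  · simp only [Function.iterate_zero, id_eq, add_sub_cancel_left, sub_sub_cancel]
    constructor <;> nlinarith
  · have hm := f.iterate_symm_strictMono n
    have h1 : 0 < f.lift.symm^[n] (x + t) - f.lift.symm^[n] x := sub_pos.2 (hm (by linarith))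
    have h2 : 0 < f.lift.symm^[n] x - f.lift.symm^[n] (x - t) := sub_pos.2 (hm (by linarith))
    have := h n hn x t ht
    rw [abs_of_pos h1, abs_of_pos h2, div_le_div_iff₀ (by linarith) h2, div_le_iff₀ h2] at this
    constructor <;> linarith

/-- The children of a Markov interval are images under F⁻⁽ⁿ⁺¹⁾ of d consecutive unit intervals.
Symmetry at scale 1 makes them comparable up to (1 + ε 1)^d, so none is much smaller than 1/d of the
parent. -/
theorem CircleEndomorphism.UniformlySymmetric.exists_markovRatio_ge (hd : 2 ≤ d)
    (hf : f.UniformlySymmetric) : ∃ c > 0, ∀ n w, c ≤ markovRatio f n w := by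
  obtain ⟨ε, hpos, -, h⟩ := hf.exists_modulus
  have h1 := hpos 1 one_pos
  have hd0 : (0 : ℝ) < d := by exact_mod_cast (by omega : 0 < d)
  refine ⟨1 / (d * (1 + ε 1) ^ d), by positivity, fun n w => ?_⟩
  rw [markovRatio, div_le_div_iff₀ (by positivity) (markovLength_pos f _ n), one_mul,
    ← sum_markovLength_append]
  obtain ⟨k, hk⟩ := exists_inverseBranch_eq f (shift w) n
  have hk' : ∀ i : ℕ, inverseBranch f (shift w) n (f.lift.symm (i : ℝ)) =
      f.lift.symm^[n + 1] ((d * k : ℝ) + i * 1) := by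
    intro i
    rw [hk, ← f.symm_add_nat_mul, Function.iterate_succ_apply]
    congr 2
    ring
  have : ∀ j ∈ Finset.univ, markovLength f (append (shift w) j) (n + 1) ≤
      (1 + ε 1) ^ d * markovLength f w (n + 1) := by
    intro j _
    simp only [markovLength_succ, shift_append, append_zero, hk']
    exact (h (n + 1) 1 one_pos).step_le (f.iterate_symm_strictMono _) one_pos (by linarith) _
      j.2 (w 0).2
  have := Finset.sum_le_card_nsmul _ _ _ this
  simp only [Finset.card_univ, Fintype.card_fin, nsmul_eq_mul] at this
  linarith

/-- As d ≥ 2, each child has a sibling taking at least the proportion c, so its own ratio is at most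
1 - c. -/
theorem CircleEndomorphism.UniformlySymmetric.exists_markovLength_le_pow (hd : 2 ≤ d)
    (hf : f.UniformlySymmetric) :
    ∃ r : ℝ, 0 ≤ r ∧ r < 1 ∧ ∀ n w, markovLength f w n ≤ r ^ n := by
  obtain ⟨c, hc, h⟩ := hf.exists_markovRatio_ge hd
  have hle : ∀ n w, markovRatio f n w ≤ 1 - c := by
    intro n w
    obtain ⟨j, hj⟩ : ∃ j : Fin d, j ≠ w 0 :=
      haveI : Nontrivial (Fin d) := Fin.nontrivial_iff_two_le.2 hd
      exists_ne _
    have h1 : w = append (shift w) (w 0) := by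
      obtain ⟨i, hi⟩ := (shift_eq_iff w (shift w)).1 rfl
      rw [hi]
      rfl
    have h2 := Finset.add_le_sum (fun i _ => hc.le.trans (h n (append (shift w) i)))
      (Finset.mem_univ j) (Finset.mem_univ (w 0)) hj
    rw [sum_markovRatio_append, ← h1] at h2
    linarith [h n (append (shift w) j)]
  have h0 : 0 ≤ 1 - c := by
    have : NeZero d := ⟨by omega⟩
    exact (hc.le.trans (h 0 (fun _ => 0))).trans (hle 0 _)
  refine ⟨1 - c, h0, by linarith, fun n => ?_⟩
  induction n with
  | zero => intro w; simp [markovLength, inverseBranch]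
  | succ n ih =>
    intro w
    have := hle n w
    rw [markovRatio, div_le_iff₀ (markovLength_pos f _ _)] at this
    rw [pow_succ']
    exact this.trans (mul_le_mul_of_nonneg_left (ih _) h0)

/-- The inverse iterates of a uniformly symmetric map are uniformly close to affine maps on small
intervals. -/
theorem CircleEndomorphism.UniformlySymmetric.exists_distortion (hf : f.UniformlySymmetric)
    {η : ℝ} (hη : 0 < η) : ∃ δ > 0, ∀ (n : ℕ) (a b x : ℝ), a < b → b - a < δ → a ≤ x → x ≤ b →
      |(f.lift.symm^[n] x - f.lift.symm^[n] a) / (f.lift.symm^[n] b - f.lift.symm^[n] a) -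
        (x - a) / (b - a)| ≤ η := by
  obtain ⟨ε, hpos, hlim, h⟩ := hf.exists_modulus
  -- The number of cells is fixed first, making 1/(N + 1) < η/2. Only then is δ taken so small that
  -- (1 + ε t)^(N + 1) < 1 + η/2 for t < δ.
  obtain ⟨N, hN⟩ := exists_nat_one_div_lt (half_pos hη)
  have hlim' : Tendsto (fun t => (1 + ε t) ^ (N + 1)) (𝓝[>] 0) (𝓝 1) := by
    simpa using (hlim.const_add 1).pow (N + 1)
  have hev := hlim'.eventually (gt_mem_nhds (by linarith : (1 : ℝ) < 1 + η / 2))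
  obtain ⟨δ, hδ, hδ'⟩ := mem_nhdsGT_iff_exists_Ioo_subset.1 hev
  refine ⟨δ, hδ, fun n a b x hab hbδ hax hxb => ?_⟩
  have hNr : (0 : ℝ) < ((N + 1 : ℕ) : ℝ) := by positivity
  have ht : 0 < (b - a) / (N + 1 : ℕ) := div_pos (sub_pos.2 hab) hNr
  have htδ : (b - a) / (N + 1 : ℕ) < δ :=
    lt_of_le_of_lt (div_le_self (sub_pos.2 hab).le (by push_cast; linarith [N.cast_nonneg (α := ℝ)]))
      hbδ
  have hmul : ((N + 1 : ℕ) : ℝ) * ((b - a) / (N + 1 : ℕ)) = b - a := by field_simp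
  have key := (h n _ ht).abs_sub_le (f.iterate_symm_strictMono n) ht
    (by linarith [hpos _ ht]) a (Nat.succ_pos N) hax
    (by rw [hmul]; linarith)
  rw [Nat.succ_eq_add_one, hmul, add_sub_cancel] at key
  have h2 : (1 + ε ((b - a) / (N + 1 : ℕ))) ^ (N + 1) < 1 + η / 2 := hδ' ⟨ht, htδ⟩
  push_cast at *
  linarith

theorem CircleEndomorphism.UniformlySymmetric.markovRatio_cauchy (hd : 2 ≤ d)
    (hf : f.UniformlySymmetric) {η : ℝ} (hη : 0 < η) :
    ∃ n₀, ∀ n ≥ n₀, ∀ m w, |markovRatio f (n + m) w - markovRatio f n w| ≤ η := by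
  obtain ⟨δ, hδ, h⟩ := hf.exists_distortion (half_pos hη)
  obtain ⟨r, hr0, hr1, hr⟩ := hf.exists_markovLength_le_pow hd
  have := (tendsto_pow_atTop_nhds_zero_of_lt_one hr0 hr1).eventually (gt_mem_nhds hδ)
  obtain ⟨n₀, hn₀⟩ := eventually_atTop.1 this
  refine ⟨n₀, fun n hn m w => ?_⟩
  have hlen : markovLength f (shift w) n < δ := (hr n _).trans_lt (hn₀ n hn)
  obtain ⟨k, hk⟩ := exists_inverseBranch_eq f (shift^[n] (shift w)) m
  have hB := inverseBranch_strictMono f (shift w) n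
  set B := inverseBranch f (shift w) n with hBdef
  have hsymm := f.lift.symm.strictMono.monotone
  have hy0 : 0 ≤ f.lift.symm ((w 0 : ℕ) : ℝ) := by
    rw [← f.symm_zero]; exact hsymm (by positivity)
  have hy1 : f.lift.symm (((w 0 : ℕ) + 1 : ℕ) : ℝ) ≤ 1 := by
    rw [← f.symm_degree]; exact hsymm (by exact_mod_cast (w 0).2)
  have hy : f.lift.symm ((w 0 : ℕ) : ℝ) ≤ f.lift.symm (((w 0 : ℕ) + 1 : ℕ) : ℝ) :=
    hsymm (by push_cast; linarith)
  have hab : B 0 + k < B 1 + k := by simpa using hB one_pos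
  have hlen' : B 1 + k - (B 0 + k) < δ := by rw [markovLength] at hlen; linarith
  -- The child has two endpoints in its parent. The relative position of each moves by at most η/2
  -- under the branch of order m.
  have e1 := h m (B 0 + k) (B 1 + k) (B (f.lift.symm ((w 0 : ℕ) : ℝ)) + k) hab hlen'
    (by simpa using hB.monotone hy0) (by simpa using hB.monotone (hy.trans hy1))
  have e2 := h m (B 0 + k) (B 1 + k) (B (f.lift.symm (((w 0 : ℕ) + 1 : ℕ) : ℝ)) + k) hab hlen'
    (by simpa using hB.monotone (hy0.trans hy)) (by simpa using hB.monotone hy1)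
  rw [markovRatio, markovRatio, markovLength_succ, markovLength_succ, markovLength, markovLength]
  simp only [inverseBranch_add, hk, ← hBdef]
  rw [abs_le] at e1 e2 ⊢
  simp only [add_sub_add_right_eq_sub, sub_div] at e1 e2 ⊢
  constructor <;> linarith [e1.1, e1.2, e2.1, e2.2]

variable (f) in
-- Each branch of finite order depends continuously on finitely many digits.
theorem continuous_markovRatio (n : ℕ) : Continuous (markovRatio f n) := by
  have hB : ∀ n x, Continuous (fun w => inverseBranch f w n x) := by
    intro n
    induction n with
    | zero => exact fun x => continuous_const
    | succ n ih =>
      intro x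
      refine f.lift.symm.continuous.comp ((ih x).add ?_)
      exact (continuous_of_discreteTopology (f := fun j : Fin d => ((j : ℕ) : ℝ))).comp
        (continuous_apply n)
  have hs : Continuous (shift : DualSpace d → DualSpace d) :=
    continuous_pi fun k => continuous_apply (k + 1)
  exact ((hB _ _).sub (hB _ _)).div (((hB _ _).sub (hB _ _)).comp hs)
    fun w => (markovLength_pos f _ n).ne'

/-- The reciprocal of a dual derivative is a positive `g`-function. -/
theorem IsDualDerivative.continuous_and_pos_and_isGFunction (hd : 2 ≤ d)
    (hf : f.UniformlySymmetric) {Ψ : DualSpace d → ℝ} (hΨ : IsDualDerivative f Ψ) :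
    Continuous Ψ ∧ (∀ w, 0 < Ψ w) ∧ IsGFunction (fun w => 1 / Ψ w) := by
  obtain ⟨c, hc, hcle⟩ := hf.exists_markovRatio_ge hd
  have hle1 : ∀ n w, markovRatio f n w ≤ 1 := by
    intro n w
    have h1 : w = append (shift w) (w 0) := by
      obtain ⟨i, hi⟩ := (shift_eq_iff w (shift w)).1 rfl
      rw [hi]
      rfl
    rw [← sum_markovRatio_append f (shift w) n]
    conv_lhs => rw [h1]
    exact Finset.single_le_sum (f := fun j => markovRatio f n (append (shift w) j))
      (fun i _ => hc.le.trans (hcle n _)) (Finset.mem_univ _)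
  have hΨ1 : ∀ w, 1 ≤ Ψ w := fun w => ge_of_tendsto' (hΨ w) fun n => by
    rw [← inv_div]
    exact (one_le_inv₀ (hc.trans_le (hcle n w))).2 (hle1 n w)
  have hpos : ∀ w, 0 < Ψ w := fun w => one_pos.trans_le (hΨ1 w)
  have hlim : ∀ w, Tendsto (fun n => markovRatio f n w) atTop (𝓝 (1 / Ψ w)) := fun w => by
    have := (hΨ w).inv₀ (hpos w).ne'
    simpa [markovRatio] using this
  -- Pointwise convergence is the hypothesis on Ψ; letting m → ∞ in the uniform Cauchy estimate
  -- makes it uniform.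
  have hunif : TendstoUniformly (markovRatio f) (fun w => 1 / Ψ w) atTop := by
    rw [Metric.tendstoUniformly_iff]
    intro η hη
    obtain ⟨n₀, hn₀⟩ := hf.markovRatio_cauchy hd (half_pos hη)
    filter_upwards [eventually_ge_atTop n₀] with n hn w
    have h1 : Tendsto (fun m => |markovRatio f (n + m) w - markovRatio f n w|) atTop
        (𝓝 |1 / Ψ w - markovRatio f n w|) := by
      refine (Tendsto.sub_const ?_ _).abs
      simpa only [add_comm] using (tendsto_add_atTop_iff_nat n).2 (hlim w)
    rw [Real.dist_eq]
    exact (le_of_tendsto' h1 fun m => hn₀ n hn m w).trans_lt (half_lt_self hη)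
  have hcont : Continuous (fun w => 1 / Ψ w) :=
    hunif.continuous (Frequently.of_forall (continuous_markovRatio f))
  refine ⟨?_, hpos, hcont, fun w => (one_div_pos.2 (hpos w)).le, fun w => ?_⟩
  · exact (hcont.inv₀ fun w => (one_div_pos.2 (hpos w)).ne').congr fun w => by simp
  · refine tendsto_nhds_unique (tendsto_finsetSum _ fun j _ => hlim (append w j)) ?_
    simp only [sum_markovRatio_append, tendsto_const_nhds]

end Circle

section GMeasure

variable {d : ℕ}

/-! ### Right cylinders -/

theorem continuous_shift : Continuous (shift : DualSpace d → DualSpace d) :=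
  continuous_pi fun k => continuous_apply (k + 1)

theorem append_shift (w : DualSpace d) : append (shift w) (w 0) = w := by
  obtain ⟨i, hi⟩ := (shift_eq_iff w (shift w)).1 rfl
  rw [hi]
  rfl

theorem append_mem_cylinder_iff {v w : DualSpace d} {j : Fin d} {n : ℕ} :
    append v j ∈ PiNat.cylinder w (n + 1) ↔ j = w 0 ∧ v ∈ PiNat.cylinder (shift w) n := by
  simp only [PiNat.mem_cylinder_iff]
  constructor
  · exact fun h => ⟨h 0 (by omega), fun i hi => h (i + 1) (by omega)⟩
  · rintro ⟨h0, h⟩ i hi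
    cases i with
    | zero => exact h0
    | succ i => exact h i (by omega)

theorem shift_image_cylinder (w : DualSpace d) (n : ℕ) :
    shift '' PiNat.cylinder w (n + 1) = PiNat.cylinder (shift w) n := by
  ext v
  constructor
  · rintro ⟨x, hx, rfl⟩ i hi
    exact hx (i + 1) (by omega)
  · exact fun hv => ⟨append v (w 0), append_mem_cylinder_iff.2 ⟨rfl, hv⟩, rfl⟩

theorem isOpen_cylinder (w : DualSpace d) (n : ℕ) : IsOpen (PiNat.cylinder w n) :=
  PiNat.isOpen_cylinder (E := fun _ => Fin d) w n

theorem measurableSet_cylinder (w : DualSpace d) (n : ℕ) : MeasurableSet (PiNat.cylinder w n) :=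
  (isOpen_cylinder w n).measurableSet

theorem exists_cylinder_subset {U : Set (DualSpace d)} (hU : IsOpen U) {w : DualSpace d}
    (hw : w ∈ U) : ∃ n, PiNat.cylinder w n ⊆ U := by
  obtain ⟨_, ⟨x, n, rfl⟩, hx, hsub⟩ :=
    (PiNat.isTopologicalBasis_cylinders (fun _ => Fin d)).exists_subset_of_mem_open hw hU
  exact ⟨n, (PiNat.mem_cylinder_iff_eq.1 hx).le.trans hsub⟩

/-- A continuous function has uniformly small oscillation on long cylinders. -/
theorem exists_forall_cylinder_abs_sub_le {φ : DualSpace d → ℝ} (hφ : Continuous φ) {η : ℝ}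
    (hη : 0 < η) : ∃ m, ∀ w, ∀ v ∈ PiNat.cylinder w m, |φ v - φ w| ≤ η := by
  have hloc : ∀ x : DualSpace d, ∃ n, ∀ v ∈ PiNat.cylinder x n, |φ v - φ x| < η / 2 := by
    intro x
    have : IsOpen {v | |φ v - φ x| < η / 2} := isOpen_lt (by fun_prop) continuous_const
    exact exists_cylinder_subset this (by simpa using hη)
  choose n hn using hloc
  -- A finite subcover by cylinders gives one length that works everywhere. Two points of a cylinder
  -- of that length lie in a common member of the cover.
  obtain ⟨t, -, ht⟩ := isCompact_univ.elim_nhds_subcover (fun x => PiNat.cylinder x (n x))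
    (fun x _ => (isOpen_cylinder x (n x)).mem_nhds (PiNat.self_mem_cylinder x _))
  refine ⟨t.sup n, fun w v hv => ?_⟩
  obtain ⟨x, hxt, hx⟩ : ∃ x ∈ t, w ∈ PiNat.cylinder x (n x) := by
    simpa using ht (Set.mem_univ w)
  have hvx : v ∈ PiNat.cylinder x (n x) := by
    intro i hi
    rw [hv i (hi.trans_le (Finset.le_sup hxt)), hx i hi]
  have h1 := hn x v hvx
  have h2 := hn x w hx
  rw [abs_lt] at h1 h2
  rw [abs_le]
  constructor <;> linarith

/-! ### The dual transfer operator on measures -/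

theorem measurable_append (j : Fin d) : Measurable (fun w : DualSpace d => append w j) :=
  (continuous_append j).measurable

instance (μ : Measure (DualSpace d)) [IsFiniteMeasure μ] : IsFiniteMeasure (tildeMeasure μ) := by
  unfold tildeMeasure
  infer_instance

theorem lintegral_tildeMeasure (μ : Measure (DualSpace d)) {φ : DualSpace d → ENNReal}
    (hφ : Measurable φ) : ∫⁻ w, φ w ∂(tildeMeasure μ) = ∑ j, ∫⁻ w, φ (append w j) ∂μ := by
  rw [tildeMeasure, lintegral_finsetSum_measure]
  exact Finset.sum_congr rfl fun j _ => lintegral_map hφ (measurable_append j)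

theorem integrable_of_continuous (μ : Measure (DualSpace d)) [IsFiniteMeasure μ]
    {φ : DualSpace d → ℝ} (hφ : Continuous φ) : Integrable φ μ :=
  hφ.integrable_of_hasCompactSupport (HasCompactSupport.of_compactSpace φ)

/-- The dual `𝓛_g^*` of the transfer operator. -/
noncomputable def dualTransfer (g : DualSpace d → ℝ) (μ : Measure (DualSpace d)) :
    Measure (DualSpace d) :=
  (tildeMeasure μ).withDensity fun w => ENNReal.ofReal (g w)

theorem continuous_transfer {ψ φ : DualSpace d → ℝ} (hψ : Continuous ψ) (hφ : Continuous φ) :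
    Continuous (transfer ψ φ) :=
  continuous_finsetSum _ fun j _ =>
    (hφ.comp (continuous_append j)).mul (hψ.comp (continuous_append j))

/-! ### Existence of g-measures -/

variable {g : DualSpace d → ℝ}

theorem IsGFunction.dualTransfer_isProbabilityMeasure (hg : IsGFunction g)
    (μ : Measure (DualSpace d)) [IsProbabilityMeasure μ] :
    IsProbabilityMeasure (dualTransfer g μ) := by
  refine ⟨?_⟩
  have hm : Measurable fun w => ENNReal.ofReal (g w) := hg.continuous.measurable.ennreal_ofReal
  rw [dualTransfer, withDensity_apply _ MeasurableSet.univ, Measure.restrict_univ,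
    lintegral_tildeMeasure _ hm, ← lintegral_finsetSum
      (f := fun j w => ENNReal.ofReal (g (append w j))) _ fun j _ => hm.comp (measurable_append j)]
  simp_rw [← ENNReal.ofReal_sum_of_nonneg fun j _ => hg.nonneg (append _ j), hg.sum_eq_one]
  simp

theorem IsGFunction.integral_dualTransfer (hg : IsGFunction g) (μ : Measure (DualSpace d))
    [IsFiniteMeasure μ] {φ : DualSpace d → ℝ} (hφ : Continuous φ) :
    ∫ w, φ w ∂(dualTransfer g μ) = ∫ w, transfer g φ w ∂μ := by
  rw [dualTransfer, integral_withDensity_eq_integral_toReal_smul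
    hg.continuous.measurable.ennreal_ofReal (ae_of_all _ fun _ => ENNReal.ofReal_lt_top)]
  simp only [ENNReal.toReal_ofReal (hg.nonneg _), smul_eq_mul]
  rw [integral_tildeMeasure μ (fun w => g w * φ w) (hg.continuous.mul hφ)]
  simp [transfer, mul_comm]

/-- A `g`-function on the compact space `Σ*` has a `g`-measure. -/
theorem IsGFunction.exists_isGMeasure (hg : IsGFunction g) [Nonempty (DualSpace d)] :
    ∃ μ, IsGMeasure g μ := by
  classical
  obtain ⟨w₀⟩ := ‹Nonempty (DualSpace d)›
  set ν : ℕ → Measure (DualSpace d) := fun n => (dualTransfer g)^[n] (Measure.dirac w₀) with hν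
  have hνp : ∀ n, IsProbabilityMeasure (ν n) := by
    intro n
    induction n with
    | zero => exact Measure.dirac.isProbabilityMeasure
    | succ n ih =>
      rw [hν]
      simp only [Function.iterate_succ_apply']
      exact hg.dualTransfer_isProbabilityMeasure _
  -- Krylov–Bogoliubov averages: applying the dual transfer operator changes the n-th average only
  -- by the two end terms divided by n + 1, as `hdiff` records.
  set μ : ℕ → Measure (DualSpace d) := fun n =>
    (n + 1 : ENNReal)⁻¹ • ∑ k ∈ Finset.range (n + 1), ν k with hμ
  have hμp : ∀ n, IsProbabilityMeasure (μ n) := by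
    refine fun n => ⟨?_⟩
    simp only [hμ, Measure.smul_apply, Measure.coe_finsetSum, Finset.sum_apply, measure_univ,
      Finset.sum_const, Finset.card_range, smul_eq_mul, nsmul_eq_mul, mul_one]
    push_cast
    exact ENNReal.inv_mul_cancel (by simp) (by finiteness)
  have hint : ∀ n (φ : DualSpace d → ℝ), Continuous φ →
      ∫ w, φ w ∂(μ n) = (n + 1 : ℝ)⁻¹ * ∑ k ∈ Finset.range (n + 1), ∫ w, φ w ∂(ν k) := by
    intro n φ hφ
    rw [hμ, integral_smul_measure,
      integral_finsetSum_measure fun k _ => integrable_of_continuous (ν k) hφ]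
    simp [ENNReal.toReal_add]
  have hdiff : ∀ n (φ : DualSpace d → ℝ), Continuous φ →
      ∫ w, transfer g φ w ∂(μ n) - ∫ w, φ w ∂(μ n) =
        (n + 1 : ℝ)⁻¹ * (∫ w, φ w ∂(ν (n + 1)) - ∫ w, φ w ∂(ν 0)) := by
    intro n φ hφ
    rw [hint n φ hφ, hint n _ (continuous_transfer hg.continuous hφ), ← mul_sub,
      ← Finset.sum_sub_distrib, ← Finset.sum_range_sub fun k => ∫ w, φ w ∂(ν k)]
    congr 1
    refine Finset.sum_congr rfl fun k _ => ?_
    rw [← hg.integral_dualTransfer _ hφ, hν]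
    simp only [Function.iterate_succ_apply']
  let P : ℕ → ProbabilityMeasure (DualSpace d) := fun n => ⟨μ n, hμp n⟩
  -- Compactness of the space of probability measures yields a limit along an ultrafilter, so no
  -- subsequence has to be extracted.
  obtain ⟨κ, -, hκ⟩ := isCompact_univ.ultrafilter_le_nhds (Ultrafilter.map P (hyperfilter ℕ))
    (by simp)
  have hlim : Tendsto P (hyperfilter ℕ : Filter ℕ) (𝓝 κ) := hκ
  rw [ProbabilityMeasure.tendsto_iff_forall_integral_tendsto] at hlim
  refine ⟨κ, inferInstance, fun φ hφ => ?_⟩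
  have h1 := (hlim (BoundedContinuousFunction.mkOfCompact
    ⟨_, continuous_transfer hg.continuous hφ⟩)).sub
    (hlim (BoundedContinuousFunction.mkOfCompact ⟨φ, hφ⟩))
  obtain ⟨C, hC⟩ := (isCompact_univ.image hφ).isBounded.exists_norm_le
  have hb : ∀ k, |∫ w, φ w ∂(ν k)| ≤ C := by
    intro k
    have := norm_integral_le_of_norm_le_const (μ := ν k) (f := φ) (C := C)
      (ae_of_all _ fun w => hC _ ⟨w, trivial, rfl⟩)
    simpa using this
  have h2 : Tendsto (fun n => ∫ w, transfer g φ w ∂(μ n) - ∫ w, φ w ∂(μ n))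
      (hyperfilter ℕ : Filter ℕ) (𝓝 0) := by
    refine Tendsto.mono_left ?_ (Nat.hyperfilter_le_atTop)
    have h3 : Tendsto (fun n : ℕ => (n + 1 : ℝ)⁻¹ * (2 * C)) atTop (𝓝 0) := by
      simpa using (tendsto_one_div_add_atTop_nhds_zero_nat (𝕜 := ℝ)).mul_const (2 * C)
    refine squeeze_zero_norm (fun n => ?_) h3
    rw [hdiff n φ hφ, norm_mul, Real.norm_of_nonneg (by positivity : (0 : ℝ) ≤ (n + 1 : ℝ)⁻¹)]
    gcongr
    have := abs_sub (∫ w, φ w ∂(ν (n + 1))) (∫ w, φ w ∂(ν 0))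
    rw [Real.norm_eq_abs]
    linarith [hb (n + 1), hb 0]
  exact sub_eq_zero.1 (tendsto_nhds_unique h1 h2)

/-! ### Density, invariance and cylinder estimates for g-measures -/

variable {μ : Measure (DualSpace d)}

/-- Continuous test functions determine a finite measure here, so the integral identity becomes μ =
g · μ̃. The density and all cylinder estimates come from this form. -/
theorem IsGMeasure.dualTransfer_eq (hg : IsGFunction g) (hμ : IsGMeasure g μ) :
    dualTransfer g μ = μ := by
  have := hμ.isProbabilityMeasure
  have := hg.dualTransfer_isProbabilityMeasure μ
  refine ext_of_forall_integral_eq_of_IsFiniteMeasure fun φ => ?_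
  rw [hg.integral_dualTransfer μ φ.continuous, hμ.fixed _ φ.continuous]

theorem IsGMeasure.absolutelyContinuous (hg : IsGFunction g) (hμ : IsGMeasure g μ) :
    μ ≪ tildeMeasure μ := by
  conv_lhs => rw [← hμ.dualTransfer_eq hg]
  exact withDensity_absolutelyContinuous _ _

theorem IsGMeasure.rnDeriv_eq (hg : IsGFunction g) (hμ : IsGMeasure g μ) :
    μ.rnDeriv (tildeMeasure μ) =ᵐ[tildeMeasure μ] fun w => ENNReal.ofReal (g w) := by
  have := hμ.isProbabilityMeasure
  have h := Measure.rnDeriv_withDensity (tildeMeasure μ)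
    (hg.continuous.measurable.ennreal_ofReal)
  rwa [← dualTransfer, hμ.dualTransfer_eq hg] at h

/-- Because g sums to 1 over preimages, 𝓛_g(φ ∘ σ*) = φ. -/
theorem IsGMeasure.isInvariantProbability (hg : IsGFunction g) (hμ : IsGMeasure g μ) :
    IsInvariantProbability μ := by
  have := hμ.isProbabilityMeasure
  refine ⟨this, continuous_shift.measurable, ?_⟩
  have := Measure.isProbabilityMeasure_map (μ := μ) (continuous_shift (d := d)).aemeasurable
  refine ext_of_forall_integral_eq_of_IsFiniteMeasure fun φ => ?_
  rw [integral_map continuous_shift.aemeasurable φ.continuous.aestronglyMeasurable,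
    ← hμ.fixed (fun w => φ (shift w)) (φ.continuous.comp continuous_shift)]
  refine integral_congr_ae (ae_of_all _ fun w => ?_)
  simp only [transfer, shift_append, ← Finset.mul_sum, hg.sum_eq_one, mul_one]

theorem IsGMeasure.measure_cylinder_succ (hg : IsGFunction g) (hμ : IsGMeasure g μ)
    (w : DualSpace d) (n : ℕ) : μ (PiNat.cylinder w (n + 1)) =
      ∫⁻ v in PiNat.cylinder (shift w) n, ENNReal.ofReal (g (append v (w 0))) ∂μ := by
  classical
  have hm : Measurable fun w => ENNReal.ofReal (g w) := hg.continuous.measurable.ennreal_ofReal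
  conv_lhs => rw [← hμ.dualTransfer_eq hg]
  rw [dualTransfer, withDensity_apply _ (measurableSet_cylinder _ _),
    ← lintegral_indicator (measurableSet_cylinder _ _),
    lintegral_tildeMeasure _ (hm.indicator (measurableSet_cylinder _ _)),
    Finset.sum_eq_single (w 0), ← lintegral_indicator (measurableSet_cylinder _ _)]
  · refine lintegral_congr fun v => ?_
    simp only [Set.indicator_apply, append_mem_cylinder_iff, true_and]
  · intro j _ hj
    simp [append_mem_cylinder_iff, hj, -PiNat.mem_cylinder_iff]
  · simp

theorem IsGMeasure.measureReal_cylinder_succ_mem_Icc (hg : IsGFunction g) (hμ : IsGMeasure g μ)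
    {w : DualSpace d} {n : ℕ} {a b : ℝ} (ha : 0 ≤ a)
    (hab : ∀ v ∈ PiNat.cylinder w (n + 1), g v ∈ Set.Icc a b) :
    μ.real (PiNat.cylinder w (n + 1)) ∈ Set.Icc (a * μ.real (PiNat.cylinder (shift w) n))
      (b * μ.real (PiNat.cylinder (shift w) n)) := by
  have := hμ.isProbabilityMeasure
  have hb : 0 ≤ b := ha.trans ((hab w (PiNat.self_mem_cylinder _ _)).1.trans
    (hab w (PiNat.self_mem_cylinder _ _)).2)
  have hab' : ∀ v ∈ PiNat.cylinder (shift w) n, g (append v (w 0)) ∈ Set.Icc a b :=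
    fun v hv => hab _ (append_mem_cylinder_iff.2 ⟨rfl, hv⟩)
  have h := hμ.measure_cylinder_succ hg w n
  have h1 : ENNReal.ofReal a * μ (PiNat.cylinder (shift w) n) ≤ μ (PiNat.cylinder w (n + 1)) := by
    rw [h, ← setLIntegral_const]
    exact setLIntegral_mono' (measurableSet_cylinder _ _) fun v hv =>
      ENNReal.ofReal_le_ofReal (hab' v hv).1
  have h2 : μ (PiNat.cylinder w (n + 1)) ≤ ENNReal.ofReal b * μ (PiNat.cylinder (shift w) n) := by
    rw [h, ← setLIntegral_const]
    exact setLIntegral_mono' (measurableSet_cylinder _ _) fun v hv =>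
      ENNReal.ofReal_le_ofReal (hab' v hv).2
  have h1' := ENNReal.toReal_mono (by finiteness) h1
  have h2' := ENNReal.toReal_mono (by finiteness) h2
  rw [ENNReal.toReal_mul, ENNReal.toReal_ofReal ha] at h1'
  rw [ENNReal.toReal_mul, ENNReal.toReal_ofReal hb] at h2'
  exact ⟨h1', h2'⟩

theorem IsGMeasure.measureReal_cylinder_pos (hg : IsGFunction g) (hpos : ∀ w, 0 < g w)
    (hμ : IsGMeasure g μ) (w : DualSpace d) (n : ℕ) : 0 < μ.real (PiNat.cylinder w n) := by
  have := hμ.isProbabilityMeasure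
  have : Nonempty (DualSpace d) := ⟨w⟩
  obtain ⟨x, -, hx⟩ := isCompact_univ.exists_isMinOn Set.univ_nonempty hg.continuous.continuousOn
  obtain ⟨y, -, hy⟩ := isCompact_univ.exists_isMaxOn Set.univ_nonempty hg.continuous.continuousOn
  induction n generalizing w with
  | zero => simp
  | succ n ih =>
    exact (mul_pos (hpos x) (ih _)).trans_le (hμ.measureReal_cylinder_succ_mem_Icc hg (hpos x).le
      (b := g y) fun v _ => ⟨hx (Set.mem_univ v), hy (Set.mem_univ v)⟩).1

/-- At a maximum point of g, another preimage of the same point carries positive weight, and the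
weights sum to 1. -/
theorem IsGFunction.exists_lt_one (hd : 2 ≤ d) (hg : IsGFunction g) (hpos : ∀ w, 0 < g w) :
    ∃ r, 0 ≤ r ∧ r < 1 ∧ ∀ w, g w ≤ r := by
  have : NeZero d := ⟨by omega⟩
  have : Nontrivial (Fin d) := Fin.nontrivial_iff_two_le.2 hd
  obtain ⟨y, -, hy⟩ := isCompact_univ.exists_isMaxOn Set.univ_nonempty hg.continuous.continuousOn
  refine ⟨g y, hg.nonneg y, ?_, fun w => hy (Set.mem_univ w)⟩
  obtain ⟨j, hj⟩ := exists_ne (y 0)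
  have := Finset.add_le_sum (fun i _ => hg.nonneg (append (shift y) i))
    (Finset.mem_univ j) (Finset.mem_univ (y 0)) hj
  rw [hg.sum_eq_one, append_shift] at this
  linarith [hpos (append (shift y) j)]

theorem IsGMeasure.exists_measureReal_cylinder_le_pow (hd : 2 ≤ d) (hg : IsGFunction g)
    (hpos : ∀ w, 0 < g w) (hμ : IsGMeasure g μ) :
    ∃ r : ℝ, 0 ≤ r ∧ r < 1 ∧ ∀ n w, μ.real (PiNat.cylinder w n) ≤ r ^ n := by
  have := hμ.isProbabilityMeasure
  obtain ⟨r, hr0, hr1, hr⟩ := hg.exists_lt_one hd hpos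
  refine ⟨r, hr0, hr1, fun n => ?_⟩
  induction n with
  | zero => simp
  | succ n ih =>
    intro w
    refine (hμ.measureReal_cylinder_succ_mem_Icc hg le_rfl
      fun v _ => ⟨hg.nonneg v, hr v⟩).2.trans ?_
    rw [pow_succ']
    exact mul_le_mul_of_nonneg_left (ih _) hr0

/-- The measure of a cylinder, relative to its image under `σ*`, is controlled by `g`. -/
theorem IsGMeasure.abs_log_cylinder_sub_le (hg : IsGFunction g) (hpos : ∀ w, 0 < g w)
    (hμ : IsGMeasure g μ) {w : DualSpace d} {n : ℕ} {η : ℝ}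
    (h : ∀ v ∈ PiNat.cylinder w (n + 1), |Real.log (g v) - Real.log (g w)| ≤ η) :
    |Real.log (μ.real (PiNat.cylinder w (n + 1))) -
      Real.log (μ.real (PiNat.cylinder (shift w) n)) - Real.log (g w)| ≤ η := by
  have hw := hpos w
  have hc := hμ.measureReal_cylinder_pos hg hpos (shift w) n
  have hc' := hμ.measureReal_cylinder_pos hg hpos w (n + 1)
  have := hμ.measureReal_cylinder_succ_mem_Icc hg (w := w) (n := n)
    (a := g w * Real.exp (-η)) (b := g w * Real.exp η) (by positivity) (fun v hv => by
      have hv' := abs_le.1 (h v hv)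
      rw [← Real.exp_log (hpos v)]
      conv => enter [1, 1, 1]; rw [← Real.exp_log hw]
      conv => enter [1, 2, 1]; rw [← Real.exp_log hw]
      rw [← Real.exp_add, ← Real.exp_add]
      exact ⟨Real.exp_le_exp.2 (by linarith), Real.exp_le_exp.2 (by linarith)⟩)
  have h1 := Real.log_le_log (by positivity) this.1
  have h2 := Real.log_le_log hc' this.2
  rw [Real.log_mul (by positivity) hc.ne', Real.log_mul hw.ne' (by positivity), Real.log_exp]
    at h1 h2
  rw [abs_le]
  constructor <;> linarith

theorem continuous_log_of_pos (hg : IsGFunction g) (hpos : ∀ w, 0 < g w) :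
    Continuous fun w => Real.log (g w) :=
  hg.continuous.log fun w => (hpos w).ne'

theorem IsGMeasure.tendsto_cylinder_ratio (hg : IsGFunction g) (hpos : ∀ w, 0 < g w)
    (hμ : IsGMeasure g μ) (w : DualSpace d) : Tendsto (fun n => μ.real (PiNat.cylinder w (n + 1)) /
      μ.real (PiNat.cylinder (shift w) n)) atTop (𝓝 (g w)) := by
  have hlog : Tendsto (fun n => Real.log (μ.real (PiNat.cylinder w (n + 1))) -
      Real.log (μ.real (PiNat.cylinder (shift w) n))) atTop (𝓝 (Real.log (g w))) := by
    rw [Metric.tendsto_atTop]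
    intro η hη
    obtain ⟨m, hm⟩ := exists_forall_cylinder_abs_sub_le (continuous_log_of_pos hg hpos)
      (half_pos hη)
    refine ⟨m, fun n hn => ?_⟩
    rw [Real.dist_eq]
    refine (hμ.abs_log_cylinder_sub_le hg hpos fun v hv => hm w v ?_).trans_lt (half_lt_self hη)
    exact PiNat.cylinder_anti w (by omega) hv
  have h := (Real.continuous_exp.tendsto _).comp hlog
  rw [Real.exp_log (hpos w)] at h
  refine h.congr fun n => ?_
  simp only [Function.comp_apply]
  rw [Real.exp_sub, Real.exp_log (hμ.measureReal_cylinder_pos hg hpos _ _),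
    Real.exp_log (hμ.measureReal_cylinder_pos hg hpos _ _)]

theorem IsGMeasure.hasCylinderDerivAt (hg : IsGFunction g) (hpos : ∀ w, 0 < g w)
    (hμ : IsGMeasure g μ) (w : DualSpace d) : HasCylinderDerivAt μ (g w)⁻¹ w := by
  rw [HasCylinderDerivAt, ← tendsto_add_atTop_iff_nat 1]
  refine ((hμ.tendsto_cylinder_ratio hg hpos w).inv₀ (hpos w).ne').congr fun n => ?_
  rw [shift_image_cylinder, inv_div]

theorem firstDiff_shift {v w : DualSpace d} (hne : w ≠ v) (h0 : w 0 = v 0) :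
    shift w ≠ shift v ∧ PiNat.firstDiff w v = PiNat.firstDiff (shift w) (shift v) + 1 := by
  have hs : shift w ≠ shift v := by
    intro h
    rw [← append_shift w, ← append_shift v, h, h0] at hne
    exact hne rfl
  refine ⟨hs, le_antisymm ?_ ?_⟩
  · by_contra! hlt
    exact PiNat.apply_firstDiff_ne (E := fun _ => Fin d) hs
      (PiNat.apply_eq_of_lt_firstDiff (E := fun _ => Fin d) (x := w) (y := v) hlt)
  · refine (PiNat.mem_cylinder_iff_le_firstDiff (E := fun _ => Fin d) hne _).1 fun i hi => ?_
    cases i with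
    | zero => exact h0
    | succ i =>
      exact PiNat.apply_eq_of_lt_firstDiff (E := fun _ => Fin d) (x := shift w) (y := shift v)
        (Nat.lt_of_succ_lt_succ hi)

/-- For v sharing the last digit of w, the quotient of distances is exactly the cylinder quotient at
length `firstDiff w v`, which tends to infinity as v → w. -/
theorem HasCylinderDerivAt.hasShiftDerivAt {L : ℝ} {w : DualSpace d}
    (h : HasCylinderDerivAt μ L w) : HasShiftDerivAt μ L w := by
  have hmem : ∀ n, ∀ᶠ v in 𝓝[≠] w, v ≠ w ∧ v ∈ PiNat.cylinder w n := fun n =>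
    eventually_mem_nhdsWithin.and (eventually_nhdsWithin_of_eventually_nhds
      ((isOpen_cylinder w n).mem_nhds (PiNat.self_mem_cylinder w n)))
  have hfd : Tendsto (fun v => PiNat.firstDiff w v) (𝓝[≠] w) atTop := by
    refine tendsto_atTop.2 fun n => ?_
    filter_upwards [hmem n] with v hv
    rw [PiNat.firstDiff_comm]
    exact (PiNat.mem_cylinder_iff_le_firstDiff (E := fun _ => Fin d) hv.1 n).1 hv.2
  refine (Tendsto.comp h hfd).congr' ?_
  filter_upwards [hmem 1] with v hv
  obtain ⟨hs, hf⟩ := firstDiff_shift (Ne.symm hv.1) (hv.2 0 one_pos).symm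
  rw [Function.comp_apply, inducedDist, inducedDist, if_neg hs, if_neg (Ne.symm hv.1), hf,
    shift_image_cylinder]

theorem IsGMeasure.isDualGeometricGibbsTypeMeasure (hd : 2 ≤ d) (hg : IsGFunction g)
    (hpos : ∀ w, 0 < g w) (hμ : IsGMeasure g μ) :
    IsDualGeometricGibbsTypeMeasure μ fun w => (g w)⁻¹ where
  isProbabilityMeasure := hμ.isProbabilityMeasure
  noAtoms w := by
    have := hμ.isProbabilityMeasure
    obtain ⟨r, hr0, hr1, hr⟩ := hμ.exists_measureReal_cylinder_le_pow hd hg hpos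
    have hle : ∀ n, μ.real {w} ≤ r ^ n := fun n =>
      (measureReal_mono (Set.singleton_subset_iff.2 (PiNat.self_mem_cylinder w n))).trans (hr n w)
    have := ge_of_tendsto' (tendsto_pow_atTop_nhds_zero_of_lt_one hr0 hr1) hle
    exact (measureReal_eq_zero_iff).1 (le_antisymm this measureReal_nonneg)
  fullSupport U hU := by
    rintro ⟨w, hw⟩
    have := hμ.isProbabilityMeasure
    obtain ⟨n, hn⟩ := exists_cylinder_subset hU hw
    exact (ENNReal.toReal_pos_iff.1 (hμ.measureReal_cylinder_pos hg hpos w n)).1.trans_le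
      (measure_mono hn)
  derivCylinder := hμ.hasCylinderDerivAt hg hpos
  derivMetric w := (hμ.hasCylinderDerivAt hg hpos w).hasShiftDerivAt

/-- The weak Gibbs property: the measure of a cylinder is a Birkhoff sum up to a subexponential
error. -/
theorem IsGMeasure.exists_abs_log_cylinder_sub_birkhoffSum_le (hg : IsGFunction g)
    (hpos : ∀ w, 0 < g w) (hμ : IsGMeasure g μ) {η : ℝ} (hη : 0 < η) :
    ∃ M, ∀ n w, |Real.log (μ.real (PiNat.cylinder w n)) -
      birkhoffSum shift (fun w => Real.log (g w)) n w| ≤ n * η + M := by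
  have := hμ.isProbabilityMeasure
  have hc := continuous_log_of_pos hg hpos
  obtain ⟨m, hm⟩ := exists_forall_cylinder_abs_sub_le hc hη
  obtain ⟨C, hC⟩ := (isCompact_univ.image hc).isBounded.exists_norm_le
  have hC' : ∀ w, |Real.log (g w)| ≤ C := fun w => hC _ ⟨w, trivial, rfl⟩
  have hlong : ∀ n ≥ m, ∀ w, |Real.log (μ.real (PiNat.cylinder w (n + 1))) -
      Real.log (μ.real (PiNat.cylinder (shift w) n)) - Real.log (g w)| ≤ η := fun n hn w =>
    hμ.abs_log_cylinder_sub_le hg hpos fun v hv => hm w v (PiNat.cylinder_anti w (by omega) hv)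
  have hshort : ∀ n w, |Real.log (μ.real (PiNat.cylinder w (n + 1))) -
      Real.log (μ.real (PiNat.cylinder (shift w) n)) - Real.log (g w)| ≤ 2 * C := fun n w =>
    hμ.abs_log_cylinder_sub_le hg hpos fun v _ => by
      linarith [abs_sub (Real.log (g v)) (Real.log (g w)), hC' v, hC' w]
  -- One factor is split off per digit. It costs η while the remaining cylinder is long, and the
  -- crude bound 2C for at most m short ones, whence `min n m`.
  have key : ∀ n w, |Real.log (μ.real (PiNat.cylinder w n)) -
      birkhoffSum shift (fun w => Real.log (g w)) n w| ≤ n * η + (min n m : ℕ) * (2 * C) := by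
    intro n
    induction n with
    | zero => simp
    | succ n ih =>
      intro w
      have hC0 : 0 ≤ 2 * C := (abs_nonneg _).trans (hshort n w)
      rw [birkhoffSum_succ']
      have h1 := abs_le.1 (ih (shift w))
      rcases le_or_gt m n with hmn | hmn
      · have h2 := abs_le.1 (hlong n hmn w)
        rw [min_eq_right hmn] at h1
        rw [min_eq_right (hmn.trans n.le_succ), abs_le]
        push_cast
        constructor <;> linarith
      · have h2 := abs_le.1 (hshort n w)
        rw [min_eq_left hmn.le] at h1
        rw [min_eq_left hmn, abs_le]
        push_cast
        constructor <;> linarith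
  refine ⟨m * (2 * C), fun n w => (key n w).trans ?_⟩
  have hC0 : 0 ≤ C := (abs_nonneg _).trans (hC' w)
  gcongr
  exact min_le_right n m

end GMeasure

/-! ### Entropy of finite partitions -/

section Partition

variable {X ι : Type*} [MeasurableSpace X] [Fintype ι] [MeasurableSpace ι]
  [MeasurableSingletonClass ι] {ν : Measure X} {ζ : X → ι}

theorem integral_comp_eq_sum [IsFiniteMeasure ν] (hζ : Measurable ζ) (F : ι → ℝ) :
    ∫ x, F (ζ x) ∂ν = ∑ a, ν.real (ζ ⁻¹' {a}) * F a := by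
  have hF : Measurable F := measurable_of_finite F
  rw [← integral_map hζ.aemeasurable hF.aestronglyMeasurable, integral_fintype .of_finite]
  simp only [smul_eq_mul, map_measureReal_apply hζ (measurableSet_singleton _)]

theorem integrable_comp_of_finite [IsFiniteMeasure ν] (hζ : Measurable ζ) (F : ι → ℝ) :
    Integrable (fun x => F (ζ x)) ν :=
  (Integrable.of_finite (μ := ν.map ζ) (f := F)).comp_measurable hζ

theorem sum_measureReal_preimage_singleton_eq_one [IsProbabilityMeasure ν] (hζ : Measurable ζ) :
    ∑ a, ν.real (ζ ⁻¹' {a}) = 1 := by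
  simpa using (integral_comp_eq_sum (ν := ν) hζ fun _ => 1).symm

theorem partitionEntropy_eq_integral [IsFiniteMeasure ν] (hζ : Measurable ζ) :
    partitionEntropy ν ζ = ∫ x, -Real.log (ν.real (ζ ⁻¹' {ζ x})) ∂ν := by
  rw [integral_comp_eq_sum hζ fun a => -Real.log (ν.real (ζ ⁻¹' {a})), partitionEntropy]
  refine Finset.sum_congr rfl fun a _ => ?_
  rw [Real.negMulLog]
  ring

/-- Gibbs' inequality. -/
theorem partitionEntropy_le_integral [IsProbabilityMeasure ν] (hζ : Measurable ζ) {q : ι → ℝ}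
    (hq : ∀ a, 0 < q a) (hq1 : ∑ a, q a ≤ 1) :
    partitionEntropy ν ζ ≤ ∫ x, -Real.log (q (ζ x)) ∂ν := by
  rw [integral_comp_eq_sum hζ fun a => -Real.log (q a), partitionEntropy]
  have key : ∀ a, Real.negMulLog (ν.real (ζ ⁻¹' {a})) ≤
      ν.real (ζ ⁻¹' {a}) * -Real.log (q a) + (q a - ν.real (ζ ⁻¹' {a})) := by
    intro a
    rcases (measureReal_nonneg (μ := ν) (s := ζ ⁻¹' {a})).eq_or_lt with h | h
    · simp [← h, (hq a).le]
    · have h1 := Real.log_le_sub_one_of_pos (div_pos (hq a) h)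
      rw [Real.log_div (hq a).ne' h.ne'] at h1
      have h2 := mul_le_mul_of_nonneg_left h1 h.le
      rw [mul_sub, mul_sub, mul_div_cancel₀ _ h.ne'] at h2
      rw [Real.negMulLog]
      linarith
  have := Finset.sum_le_sum fun a (_ : a ∈ Finset.univ) => key a
  rw [Finset.sum_add_distrib, Finset.sum_sub_distrib,
    sum_measureReal_preimage_singleton_eq_one hζ] at this
  linarith

end Partition

theorem measurable_itinerary {X ι : Type*} [MeasurableSpace X] [MeasurableSpace ι] {T : X → X}
    (hT : Measurable T) {ξ : X → ι} (hξ : Measurable ξ) (n : ℕ) : Measurable (itinerary T ξ n) :=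
  measurable_pi_lambda _ fun i => hξ.comp (hT.iterate i)

theorem integral_birkhoffSum {X : Type*} [MeasurableSpace X] {ν : Measure X} {T : X → X}
    (hT : MeasurePreserving T ν ν) {φ : X → ℝ} (hφ : Integrable φ ν) (n : ℕ) :
    Integrable (birkhoffSum T φ n) ν ∧ ∫ x, birkhoffSum T φ n x ∂ν = n * ∫ x, φ x ∂ν := by
  have hi : ∀ k, Integrable (fun x => φ (T^[k] x)) ν := fun k =>
    (hT.iterate k).integrable_comp_of_integrable hφ
  have hk : ∀ k, ∫ x, φ (T^[k] x) ∂ν = ∫ x, φ x ∂ν := by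
    intro k
    have h := (hT.iterate k).map_eq
    conv_rhs => rw [← h]
    rw [integral_map (hT.iterate k).aemeasurable (by rw [h]; exact hφ.aestronglyMeasurable)]
  refine ⟨integrable_finsetSum _ fun k _ => hi k, ?_⟩
  simp only [birkhoffSum]
  rw [integral_finsetSum _ fun k _ => hi k]
  simp [hk]

/-! ### Weak Gibbs measures: pressure and lower entropy bound -/

variable {d : ℕ}

/-- The word `j_{n-1} ⋯ j₀` formed by the last `n` digits. -/
def word (n : ℕ) (w : DualSpace d) : Fin n → Fin d := fun i => w i

theorem measurable_word (n : ℕ) : Measurable (word n : DualSpace d → _) :=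
  measurable_pi_lambda _ fun _ => measurable_pi_apply _

theorem word_preimage_singleton (n : ℕ) (w : DualSpace d) :
    word n ⁻¹' {word n w} = PiNat.cylinder w n := by
  ext v
  simp only [Set.mem_preimage, Set.mem_singleton_iff, funext_iff, word, PiNat.mem_cylinder_iff]
  exact ⟨fun h i hi => h ⟨i, hi⟩, fun h i => h i i.2⟩

theorem word_surjective (hd : 0 < d) (n : ℕ) :
    Function.Surjective (word n : DualSpace d → _) := fun u =>
  ⟨fun k => if h : k < n then u ⟨k, h⟩ else ⟨0, hd⟩, funext fun i => by simp [word]⟩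

theorem itinerary_digit (n : ℕ) :
    itinerary shift (fun w : DualSpace d => w 0) n = word n := by
  ext w i
  simp [itinerary, word, iterate_shift_apply]

/-- A weak form of the Gibbs property for the potential `φ`, with pressure zero: the measure of a
cylinder is the exponential of a Birkhoff sum up to a subexponential error. -/
structure IsWeakGibbs (μ : Measure (DualSpace d)) (φ : DualSpace d → ℝ) : Prop where
  cylinder_pos : ∀ w n, 0 < μ.real (PiNat.cylinder w n)
  exists_bound : ∀ η > 0, ∃ M, ∀ n w,
    |Real.log (μ.real (PiNat.cylinder w n)) - birkhoffSum shift φ n w| ≤ n * η + M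

variable {μ : Measure (DualSpace d)} {φ : DualSpace d → ℝ}

theorem tendsto_div_of_forall_abs_sub_le {u : ℕ → ℝ} {c : ℝ}
    (h : ∀ η > 0, ∃ M, ∀ n : ℕ, |u n - n * c| ≤ n * η + M) :
    Tendsto (fun n : ℕ => u n / n) atTop (𝓝 c) := by
  rw [Metric.tendsto_atTop]
  intro η hη
  obtain ⟨M, hM⟩ := h (η / 2) (half_pos hη)
  obtain ⟨N, hN⟩ := exists_nat_gt (2 * M / η)
  refine ⟨N + 1, fun n hn => ?_⟩
  have hn0 : (0 : ℝ) < n := by exact_mod_cast (by omega : 0 < n)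
  have hnN : (N : ℝ) ≤ n := by exact_mod_cast (by omega : N ≤ n)
  have hMn : M < n * (η / 2) := by
    rw [div_lt_iff₀ hη] at hN
    nlinarith
  have : u n / n - c = (u n - n * c) / n := by field_simp
  rw [Real.dist_eq, this, abs_div, abs_of_pos hn0, div_lt_iff₀ hn0]
  linarith [hM n]

/-- Each supremum in the partition sum equals the measure of its cylinder up to a factor exp(±(nη +
M)), and these measures sum to 1. -/
theorem IsWeakGibbs.hasPressure (hd : 0 < d) [IsProbabilityMeasure μ] (h : IsWeakGibbs μ φ) :
    HasPressure φ 0 := by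
  refine tendsto_div_of_forall_abs_sub_le fun η hη => ?_
  obtain ⟨M, hM⟩ := h.exists_bound η hη
  refine ⟨M, fun n => ?_⟩
  set S : (Fin n → Fin d) → ℝ := fun u => sSup ((fun w => Real.exp (birkhoffSum shift φ n w)) ''
        {w : DualSpace d | ∀ i : Fin n, w i = u i}) with hS
  have hset : ∀ w : DualSpace d, {v : DualSpace d | ∀ i : Fin n, v i = word n w i} =
      PiNat.cylinder w n := by
    intro w
    rw [← word_preimage_singleton]
    ext v
    simp [word, funext_iff]
  have hexp : ∀ w, Real.exp (birkhoffSum shift φ n w) ∈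
      Set.Icc (μ.real (PiNat.cylinder w n) * Real.exp (-(n * η + M)))
        (μ.real (PiNat.cylinder w n) * Real.exp (n * η + M)) := by
    intro w
    have := abs_le.1 (hM n w)
    have hlog := Real.exp_log (h.cylinder_pos w n)
    rw [← hlog, ← Real.exp_add, ← Real.exp_add]
    exact ⟨Real.exp_le_exp.2 (by linarith), Real.exp_le_exp.2 (by linarith)⟩
  have hup : ∀ w, ∀ v ∈ PiNat.cylinder w n, Real.exp (birkhoffSum shift φ n v) ≤
      μ.real (PiNat.cylinder w n) * Real.exp (n * η + M) := by
    intro w v hv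
    rw [← PiNat.mem_cylinder_iff_eq.1 hv]
    exact (hexp v).2
  have hSu : ∀ u, S u ∈ Set.Icc (μ.real (word n ⁻¹' {u}) * Real.exp (-(n * η + M)))
        (μ.real (word n ⁻¹' {u}) * Real.exp (n * η + M)) := by
    intro u
    obtain ⟨w, rfl⟩ := word_surjective hd n u
    simp only [hS]
    rw [hset, word_preimage_singleton]
    constructor
    · refine (hexp w).1.trans (le_csSup
        ⟨μ.real (PiNat.cylinder w n) * Real.exp (n * η + M), ?_⟩
        ⟨w, PiNat.self_mem_cylinder w n, rfl⟩)
      rintro _ ⟨v, hv, rfl⟩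
      exact hup w v hv
    · refine csSup_le (Set.Nonempty.image _ ⟨w, PiNat.self_mem_cylinder w n⟩) ?_
      rintro _ ⟨v, hv, rfl⟩
      exact hup w v hv
  have h1 := Finset.sum_le_sum fun u (_ : u ∈ Finset.univ) => (hSu u).1
  have h2 := Finset.sum_le_sum fun u (_ : u ∈ Finset.univ) => (hSu u).2
  rw [← Finset.sum_mul, sum_measureReal_preimage_singleton_eq_one (measurable_word n),
    one_mul] at h1 h2
  have h3 := Real.log_le_log (Real.exp_pos _) h1
  have h4 := Real.log_le_log ((Real.exp_pos _).trans_le h1) h2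
  rw [Real.log_exp] at h3 h4
  rw [mul_zero, sub_zero, abs_le]
  exact ⟨h3, h4⟩

/-- The Kolmogorov–Sinai entropy of an invariant weak Gibbs measure is at least `-∫ φ`. -/
theorem IsWeakGibbs.neg_integral_le_metricEntropy [IsProbabilityMeasure μ]
    (h : IsWeakGibbs μ φ) (hinv : MeasurePreserving shift μ μ) (hφ : Integrable φ μ) :
    ((-∫ w, φ w ∂μ : ℝ) : EReal) ≤ metricEntropy μ shift := by
  have hlim : Tendsto (fun n : ℕ => partitionEntropy μ (word n) / n) atTop
      (𝓝 (-∫ w, φ w ∂μ)) := by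
    refine tendsto_div_of_forall_abs_sub_le fun η hη => ?_
    obtain ⟨M, hM⟩ := h.exists_bound η hη
    refine ⟨M, fun n => ?_⟩
    obtain ⟨hi, he⟩ := integral_birkhoffSum hinv hφ n
    have hi' := integrable_comp_of_finite (ν := μ) (measurable_word n)
      fun a => -Real.log (μ.real (word n ⁻¹' {a}))
    rw [partitionEntropy_eq_integral (measurable_word n), mul_neg, sub_neg_eq_add, ← he,
      ← integral_add hi' hi, ← Real.norm_eq_abs]
    have := norm_integral_le_of_norm_le_const (μ := μ) (C := n * η + M)
      (f := fun w => -Real.log (μ.real (word n ⁻¹' {word n w})) + birkhoffSum shift φ n w)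
      (ae_of_all _ fun w => by
        rw [word_preimage_singleton, Real.norm_eq_abs, ← abs_neg]
        convert hM n w using 2
        ring)
    simpa using this
  -- The partition by the last digit, one candidate in the supremum, already attains the value.
  rw [← ((continuous_coe_real_ereal.tendsto _).comp hlim).limsup_eq]
  refine le_trans (le_of_eq ?_) (le_iSup_of_le d (le_iSup_of_le (fun w => w 0)
    (le_iSup_of_le (measurable_pi_apply 0) le_rfl)))
  simp only [itinerary_digit]
  rfl

/-! ### The upper bound for the free energy -/

open scoped symmDiff in
-- Sets depending on finitely many digits form an algebra generating the σ-algebra, hence are dense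
-- in measure.
theorem exists_cylinder_approx_set (ν : Measure (DualSpace d)) [IsFiniteMeasure ν]
    {s : Set (DualSpace d)} (hs : MeasurableSet s) {δ : ℝ} (hδ : 0 < δ) :
    ∃ (t : Set (DualSpace d)) (m : ℕ), (∀ w, ∀ v ∈ PiNat.cylinder w m, v ∈ t ↔ w ∈ t) ∧
      ν (s ∆ t) < ENNReal.ofReal δ := by
  have hdense : ν.MeasureDense (measurableCylinders fun _ : ℕ => Fin d) :=
    Measure.MeasureDense.of_generateFrom_isSetAlgebra_finite ν isSetAlgebra_measurableCylinders
      generateFrom_measurableCylinders.symm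
  obtain ⟨t, ht, hst⟩ := hdense.approx s hs (measure_ne_top ν s) δ hδ
  simp only [measurableCylinders_nat, Set.mem_iUnion, Set.mem_singleton_iff] at ht
  obtain ⟨N, S, -, rfl⟩ := ht
  refine ⟨_, N + 1, fun w v hv => ?_, hst⟩
  have : (Finset.Iic N).restrict v = (Finset.Iic N).restrict w := by
    ext i
    rw [Finset.restrict, Finset.restrict, hv i (Nat.lt_succ_of_le (Finset.mem_Iic.1 i.2))]
  rw [mem_cylinder, mem_cylinder, this]

/-- A finite measurable partition of `Σ*` agrees, up to a set of small measure, with a partition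
into unions of cylinders of a fixed length. -/
theorem exists_cylinder_approx (ν : Measure (DualSpace d)) [IsFiniteMeasure ν] {k : ℕ}
    [NeZero k] {ξ : DualSpace d → Fin k} (hξ : Measurable ξ) {δ : ℝ} (hδ : 0 < δ) :
    ∃ (θ : DualSpace d → Fin k) (m : ℕ), (∀ w, ∀ v ∈ PiNat.cylinder w m, θ v = θ w) ∧
      ν.real {w | ξ w ≠ θ w} ≤ δ := by
  classical
  have hk : (0 : ℝ) < k := by exact_mod_cast NeZero.pos k
  choose t m hm ht using fun a : Fin k => exists_cylinder_approx_set ν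
    (hξ (measurableSet_singleton a)) (div_pos hδ hk)
  -- The approximating sets `t a` need not be disjoint or cover. `Θ` picks a label among those
  -- available, with default 0, and returns the only label when there is just one; so θ can differ
  -- from ξ only on the symmetric differences.
  let Θ : Set (Fin k) → Fin k := fun s => if h : s.Nonempty then h.some else 0
  have hΘ : ∀ a, Θ {a} = a := fun a => by
    have h : ({a} : Set (Fin k)).Nonempty := Set.singleton_nonempty a
    simp only [Θ, dif_pos h]
    exact h.some_mem
  refine ⟨fun w => Θ {a | w ∈ t a}, Finset.univ.sup m, fun w v hv => ?_, ?_⟩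
  · refine congrArg Θ (Set.ext fun a => ?_)
    exact hm a w v (PiNat.cylinder_anti w (Finset.le_sup (Finset.mem_univ a)) hv)
  · have hsub : {w | ξ w ≠ Θ {a | w ∈ t a}} ⊆ ⋃ a, symmDiff (ξ ⁻¹' {a}) (t a) := by
      intro w hw
      by_contra hcon
      simp only [Set.mem_iUnion, not_exists, Set.mem_symmDiff, Set.mem_preimage,
        Set.mem_singleton_iff] at hcon
      refine hw ?_
      have : {a | w ∈ t a} = {ξ w} := by
        ext a
        have := hcon a
        simp only [Set.mem_ofPred_eq, Set.mem_singleton_iff]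
        constructor
        · intro h
          by_contra h'
          exact this (Or.inr ⟨h, fun e => h' e.symm⟩)
        · rintro rfl
          by_contra h
          exact this (Or.inl ⟨rfl, h⟩)
      rw [this, hΘ]
    have hle : ν {w | ξ w ≠ Θ {a | w ∈ t a}} ≤ ENNReal.ofReal δ := by
      calc ν {w | ξ w ≠ Θ {a | w ∈ t a}} ≤ ∑ a, ν (symmDiff (ξ ⁻¹' {a}) (t a)) :=
            (measure_mono hsub).trans (measure_iUnion_fintype_le _ _)
        _ ≤ ∑ _a : Fin k, ENNReal.ofReal (δ / k) := Finset.sum_le_sum fun a _ => (ht a).le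
        _ = ENNReal.ofReal δ := by
            rw [← ENNReal.ofReal_sum_of_nonneg fun _ _ => by positivity]
            simp [mul_div_cancel₀ _ hk.ne']
    exact ENNReal.toReal_le_of_le_ofReal hδ.le hle

theorem measurable_of_forall_cylinder {α : Type*} [MeasurableSpace α] {θ : DualSpace d → α}
    {m : ℕ} (h : ∀ w, ∀ v ∈ PiNat.cylinder w m, θ v = θ w) : Measurable θ := by
  intro s _
  refine IsOpen.measurableSet (isOpen_iff_mem_nhds.2 fun w hw => ?_)
  filter_upwards [(isOpen_cylinder w m).mem_nhds (PiNat.self_mem_cylinder w m)] with v hv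
  rw [Set.mem_preimage, h w v hv]
  exact hw

/-- A transition kernel on `Fin k` that leaves a label unchanged with probability at least
`1 - δ` and gives weight at least `δ / k` to each label. -/
noncomputable def noise (k : ℕ) (δ : ℝ) (b a : Fin k) : ℝ := if a = b then 1 - δ else δ / k

theorem noise_pos {k : ℕ} {δ : ℝ} (h0 : 0 < δ) (h1 : δ < 1) (b a : Fin k) : 0 < noise k δ b a := by
  have : (0 : ℝ) < k := by exact_mod_cast (Nat.zero_le _).trans_lt a.2
  unfold noise
  split_ifs
  · linarith
  · positivity

theorem sum_noise_le_one {k : ℕ} {δ : ℝ} (h0 : 0 < δ) (b : Fin k) : ∑ a, noise k δ b a ≤ 1 := by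
  have hk : (0 : ℝ) < k := by exact_mod_cast (Nat.zero_le _).trans_lt b.2
  have : ∀ a, noise k δ b a ≤ (if a = b then 1 - δ else 0) + δ / k := fun a => by
    unfold noise
    split_ifs
    · linarith [div_pos h0 hk]
    · simp
  refine (Finset.sum_le_sum fun a _ => this a).trans ?_
  rw [Finset.sum_add_distrib]
  simp [mul_div_cancel₀ _ hk.ne']

/-- The left side bounds the mean logarithmic cost of the channel when the two labels disagree with
probability at most δ. It vanishes as δ → 0 because δ log δ does. -/
theorem exists_noise_cost_le (k : ℕ) [NeZero k] {η : ℝ} (hη : 0 < η) :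
    ∃ δ, 0 < δ ∧ δ < 1 ∧ -Real.log (1 - δ) + δ * -Real.log (δ / k) ≤ η := by
  have h1 : Tendsto (fun δ : ℝ => -Real.log (1 - δ)) (𝓝 0) (𝓝 0) := by
    have : ContinuousAt (fun δ : ℝ => -Real.log (1 - δ)) 0 :=
      ((continuousAt_const.sub continuousAt_id).log (by simp)).neg
    simpa [ContinuousAt] using this
  have h2 : Tendsto (fun δ : ℝ => Real.negMulLog δ + δ * Real.log k) (𝓝 0) (𝓝 0) := by
    have : Continuous (fun δ : ℝ => Real.negMulLog δ + δ * Real.log k) :=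
      Real.continuous_negMulLog.add (continuous_id.mul continuous_const)
    simpa using this.tendsto 0
  have h3 := (h1.add h2).mono_left (nhdsWithin_le_nhds (s := Set.Ioi 0))
  rw [add_zero] at h3
  obtain ⟨δ, hδ, hδ0, hδ1⟩ := ((h3.eventually (gt_mem_nhds hη)).and
    (Ioo_mem_nhdsGT (zero_lt_one' ℝ))).exists
  refine ⟨δ, hδ0, hδ1, le_trans (le_of_eq ?_) hδ.le⟩
  rw [Real.log_div hδ0.ne' (by simpa using NeZero.ne k), Real.negMulLog]
  ring

/-- Gibbs' inequality needs a reference distribution on itineraries that is bounded below along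
ξ-itineraries. The cylinder partition θ supplies the bound through the Gibbs property of μ, and the
noise keeps it positive where ξ and θ disagree, at a mean cost of at most η/2 per step. -/
theorem IsWeakGibbs.partitionEntropy_le [IsProbabilityMeasure μ] (h : IsWeakGibbs μ φ)
    {ν : Measure (DualSpace d)} (hν : IsInvariantProbability ν) (hφ : Integrable φ ν) {k : ℕ}
    [NeZero k] {ξ : DualSpace d → Fin k} (hξ : Measurable ξ) {η : ℝ} (hη : 0 < η) :
    ∃ M, ∀ n : ℕ, partitionEntropy ν (itinerary shift ξ n) ≤ n * (-∫ w, φ w ∂ν + η) + M := by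
  have := hν.1
  obtain ⟨δ, hδ0, hδ1, hδ⟩ := exists_noise_cost_le k (half_pos hη)
  obtain ⟨θ, m, hθ, hνθ⟩ := exists_cylinder_approx ν hξ hδ0
  have hθm := measurable_of_forall_cylinder hθ
  obtain ⟨M, hM⟩ := h.exists_bound (η / 2) (half_pos hη)
  have hshift := (continuous_shift (d := d)).measurable
  set ℓ : DualSpace d → ℝ := fun w => -Real.log (noise k δ (θ w) (ξ w)) with hℓ
  have hℓi : Integrable ℓ ν := integrable_comp_of_finite (hθm.prodMk hξ)
    fun p => -Real.log (noise k δ p.1 p.2)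
  have hℓint : ∫ w, ℓ w ∂ν ≤ η / 2 := by
    have hE : MeasurableSet {w | ξ w ≠ θ w} :=
      (measurableSet_eq_fun hξ hθm).compl
    have hk1 : (1 : ℝ) ≤ k := by exact_mod_cast NeZero.pos k
    have hle : ∀ w, ℓ w ≤ -Real.log (1 - δ) +
        {w | ξ w ≠ θ w}.indicator (fun _ => -Real.log (δ / k)) w := by
      intro w
      have : 0 ≤ -Real.log (1 - δ) :=
        neg_nonneg.2 (Real.log_nonpos (by linarith) (by linarith))
      by_cases hw : ξ w = θ w <;> simp [hℓ, noise, hw, this]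
    have hi : Integrable ({w | ξ w ≠ θ w}.indicator fun _ => -Real.log (δ / k)) ν :=
      (integrable_const _).indicator hE
    refine (integral_mono hℓi ((integrable_const _).add hi) hle).trans (le_trans ?_ hδ)
    have hneg : 0 ≤ -Real.log (δ / k) := neg_nonneg.2 (Real.log_nonpos (by positivity)
      ((div_le_one (by linarith)).2 (by linarith)))
    rw [integral_add' (integrable_const _) hi, integral_indicator_const _ hE]
    simp only [integral_const, probReal_univ, smul_eq_mul, one_mul]
    gcongr
  refine ⟨m * (|∫ w, φ w ∂ν| + η / 2) + M, fun n => ?_⟩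
  -- The weight of a as the noisy version of the θ-itinerary of a μ-random point; the total weight
  -- is at most 1 since the noise is sub-stochastic.
  set q : (Fin n → Fin k) → ℝ := fun a =>
    ∫ x, ∏ i : Fin n, noise k δ (θ (shift^[i] x)) (a i) ∂μ with hq
  have hitin : ∀ (ψ : (Fin n → Fin k) → ℝ), Integrable (fun x => ψ (itinerary shift θ n x)) μ :=
    integrable_comp_of_finite (measurable_itinerary hshift hθm n)
  have hqi : ∀ a : Fin n → Fin k,
      Integrable (fun x => ∏ i : Fin n, noise k δ (θ (shift^[i] x)) (a i)) μ :=
    fun a => hitin fun b => ∏ i, noise k δ (b i) (a i)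
  have hq1 : ∑ a, q a ≤ 1 := by
    rw [hq, ← integral_finsetSum _ fun a _ => hqi a]
    have : ∀ x : DualSpace d,
        ∑ a : Fin n → Fin k, ∏ i : Fin n, noise k δ (θ (shift^[i] x)) (a i) ≤ 1 := by
      intro x
      rw [← Fintype.piFinset_univ, ← Finset.prod_univ_sum]
      exact Finset.prod_le_one (fun i _ => Finset.sum_nonneg fun a _ => (noise_pos hδ0 hδ1 _ a).le)
        fun i _ => sum_noise_le_one hδ0 _
    refine (integral_mono (integrable_finsetSum _ fun a _ => hqi a) (integrable_const 1)
      this).trans ?_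
    simp
  -- The first n labels of the θ-itinerary depend on n + m digits only, so the integrand is constant
  -- on [w_{n+m}] and restricting to that cylinder gives a lower bound.
  have hqge : ∀ (a : Fin n → Fin k) (w : DualSpace d), μ.real (PiNat.cylinder w (n + m)) *
      ∏ i : Fin n, noise k δ (θ (shift^[i] w)) (a i) ≤ q a := by
    intro a w
    rw [← smul_eq_mul, ← setIntegral_const]
    have heq : ∫ x in PiNat.cylinder w (n + m), ∏ i : Fin n, noise k δ (θ (shift^[i] w)) (a i) ∂μ =
        ∫ x in PiNat.cylinder w (n + m), ∏ i : Fin n, noise k δ (θ (shift^[i] x)) (a i) ∂μ := by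
      refine setIntegral_congr_fun (measurableSet_cylinder _ _) fun x hx => ?_
      refine Finset.prod_congr rfl fun i _ => ?_
      rw [hθ (shift^[i] w) (shift^[i] x)]
      intro j hj
      rw [iterate_shift_apply, iterate_shift_apply]
      exact hx _ (by omega)
    rw [heq]
    exact setIntegral_le_integral (hqi a) (ae_of_all _ fun x =>
      Finset.prod_nonneg fun i _ => (noise_pos hδ0 hδ1 _ _).le)
  have hprod : ∀ (a : Fin n → Fin k) (w : DualSpace d),
      0 < ∏ i : Fin n, noise k δ (θ (shift^[i] w)) (a i) := fun a w =>
    Finset.prod_pos fun i _ => noise_pos hδ0 hδ1 _ _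
  obtain ⟨w₀⟩ := nonempty_of_isProbabilityMeasure ν
  have hqpos : ∀ a, 0 < q a := fun a =>
    (mul_pos (h.cylinder_pos w₀ _) (hprod a w₀)).trans_le (hqge a w₀)
  have hlog : ∀ w, -Real.log (q (itinerary shift ξ n w)) ≤
      (-birkhoffSum shift φ (n + m) w + birkhoffSum shift ℓ n w) +
        (((n + m : ℕ) : ℝ) * (η / 2) + M) := by
    intro w
    have h1 := Real.log_le_log (mul_pos (h.cylinder_pos w _) (hprod _ w))
      (hqge (itinerary shift ξ n w) w)
    rw [Real.log_mul (h.cylinder_pos w _).ne' (hprod _ w).ne',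
      Real.log_prod fun i _ => (noise_pos hδ0 hδ1 _ _).ne'] at h1
    have h2 := abs_le.1 (hM (n + m) w)
    have h3 : birkhoffSum shift ℓ n w =
        -∑ i : Fin n, Real.log (noise k δ (θ (shift^[i] w)) (itinerary shift ξ n w i)) := by
      rw [birkhoffSum, ← Fin.sum_univ_eq_sum_range (fun i => ℓ (shift^[i] w)),
        ← Finset.sum_neg_distrib]
      rfl
    linarith
  obtain ⟨hi1, he1⟩ := integral_birkhoffSum hν.2 hφ (n + m)
  obtain ⟨hi2, he2⟩ := integral_birkhoffSum hν.2 hℓi n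
  have hξn := measurable_itinerary hshift hξ n
  have hfin := (partitionEntropy_le_integral hξn hqpos hq1).trans
    (integral_mono (integrable_comp_of_finite hξn fun a => -Real.log (q a))
      ((hi1.neg.add hi2).add (integrable_const _)) hlog)
  rw [integral_add' (hi1.neg.add hi2) (integrable_const _), integral_add' hi1.neg hi2,
    integral_neg', he1, he2, integral_const, probReal_univ, one_smul] at hfin
  have hn : (n : ℝ) * ∫ w, ℓ w ∂ν ≤ n * (η / 2) := by gcongr
  have hm' : (m : ℝ) * -∫ w, φ w ∂ν ≤ m * |∫ w, φ w ∂ν| := by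
    gcongr
    exact neg_le_abs _
  push_cast at hfin
  linarith

/-- The variational inequality `h_ν(σ*) ≤ -∫ φ dν`. -/
theorem IsWeakGibbs.metricEntropy_le [IsProbabilityMeasure μ] (h : IsWeakGibbs μ φ)
    {ν : Measure (DualSpace d)} (hν : IsInvariantProbability ν) (hφ : Integrable φ ν) :
    metricEntropy ν shift ≤ ((-∫ w, φ w ∂ν : ℝ) : EReal) := by
  have := hν.1
  obtain ⟨w₀⟩ := nonempty_of_isProbabilityMeasure ν
  refine iSup_le fun k => iSup_le fun ξ => iSup_le fun hξ => ?_
  have : NeZero k := ⟨by rintro rfl; exact (ξ w₀).elim0⟩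
  -- It suffices to bound by every real c above -∫ φ dν; half of the gap serves as η, and M/n
  -- absorbs the rest.
  refine EReal.le_of_forall_lt_iff_le.1 fun c hc => ?_
  rw [EReal.coe_lt_coe_iff] at hc
  obtain ⟨M, hM⟩ := h.partitionEntropy_le hν hφ hξ (half_pos (sub_pos.2 hc))
  have hlim : Tendsto (fun n : ℕ => (-∫ w, φ w ∂ν + (c - -∫ w, φ w ∂ν) / 2) + M / n) atTop
      (𝓝 (-∫ w, φ w ∂ν + (c - -∫ w, φ w ∂ν) / 2)) := by
    simpa using (tendsto_const_div_atTop_nhds_zero_nat M).const_add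
      (-∫ w, φ w ∂ν + (c - -∫ w, φ w ∂ν) / 2)
  refine limsup_le_of_le (by isBoundedDefault) ?_
  filter_upwards [hlim.eventually (gt_mem_nhds (by linarith : _ < c)), eventually_gt_atTop 0]
    with n hn hn0
  have hn0' : (0 : ℝ) < n := by exact_mod_cast hn0
  rw [EReal.coe_le_coe_iff]
  refine le_trans ?_ hn.le
  rw [div_le_iff₀ hn0', add_mul, div_mul_cancel₀ _ hn0'.ne', mul_comm]
  exact hM n

/-- An invariant weak Gibbs measure is an equilibrium state. -/
theorem IsWeakGibbs.isEquilibriumState (hd : 0 < d) (h : IsWeakGibbs μ φ)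
    (hinv : IsInvariantProbability μ) (hφ : Continuous φ) : IsEquilibriumState μ φ 0 := by
  have := hinv.1
  have hle : ∀ ν, IsInvariantProbability ν → freeEnergy φ ν ≤ ((0 : ℝ) : EReal) := by
    intro ν hν
    have := hν.1
    have := add_le_add_left (h.metricEntropy_le hν (integrable_of_continuous ν hφ))
      ((∫ w, φ w ∂ν : ℝ) : EReal)
    rwa [← EReal.coe_add, neg_add_cancel] at this
  have hge : ((0 : ℝ) : EReal) ≤ freeEnergy φ μ := by
    have := add_le_add_left (h.neg_integral_le_metricEntropy hinv.2
      (integrable_of_continuous μ hφ)) ((∫ w, φ w ∂μ : ℝ) : EReal)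
    rwa [← EReal.coe_add, neg_add_cancel] at this
  have heq := le_antisymm (hle μ hinv) hge
  refine ⟨hinv, h.hasPressure hd, heq, ?_, ?_⟩
  · rintro _ ⟨ν, hν, rfl⟩
    exact hle ν hν
  · exact fun b hb => hb ⟨μ, hinv, heq.symm⟩

theorem IsGMeasure.isWeakGibbs {d : ℕ} {g : DualSpace d → ℝ} {μ : Measure (DualSpace d)}
    (hg : IsGFunction g) (hpos : ∀ w, 0 < g w) (hμ : IsGMeasure g μ) :
    IsWeakGibbs μ fun w => Real.log (g w) where
  cylinder_pos := hμ.measureReal_cylinder_pos hg hpos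
  exists_bound _ hη := hμ.exists_abs_log_cylinder_sub_birkhoffSum_le hg hpos hη

end DualGibbs

theorem mainTheorem1 (d : ℕ) (hd : 2 ≤ d) (Ψ : DualGibbs.DualSpace d → ℝ)
    (hΨ : Ψ ∈ DualGibbs.TeichmullerUS d) :
    Continuous Ψ ∧ (∀ w, 0 < Ψ w) ∧
    ∃ μ : Measure (DualGibbs.DualSpace d),
      DualGibbs.IsDualGeometricGibbsTypeMeasure μ Ψ ∧
      DualGibbs.IsGFunction (fun w => 1 / Ψ w) ∧
      DualGibbs.IsGMeasure (fun w => 1 / Ψ w) μ ∧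
      μ ≪ DualGibbs.tildeMeasure μ ∧
      μ.rnDeriv (DualGibbs.tildeMeasure μ)
        =ᵐ[DualGibbs.tildeMeasure μ] (fun w => ENNReal.ofReal (1 / Ψ w)) ∧
      DualGibbs.IsEquilibriumState μ (fun w => -Real.log (Ψ w)) 0 := by
  obtain ⟨f, hf, hfΨ⟩ := hΨ
  obtain ⟨hcont, hΨpos, hg⟩ := hfΨ.continuous_and_pos_and_isGFunction hd hf
  have hpos : ∀ w, 0 < 1 / Ψ w := fun w => one_div_pos.2 (hΨpos w)
  have : NeZero d := ⟨by omega⟩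
  obtain ⟨μ, hμ⟩ := hg.exists_isGMeasure
  refine ⟨hcont, hΨpos, μ, ?_, hg, hμ, hμ.absolutelyContinuous hg, hμ.rnDeriv_eq hg, ?_⟩
  · simpa using hμ.isDualGeometricGibbsTypeMeasure hd hg hpos
  · have := (hμ.isWeakGibbs hg hpos).isEquilibriumState (by omega)
      (hμ.isInvariantProbability hg) (DualGibbs.continuous_log_of_pos hg hpos)
    simpa using this
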